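/- Let $k\ge 1$, let $\varepsilon_1,\dots,\varepsilon_k\in\{+1,-1\}$, and let $f_1,\dots,f_k:\mathbb{R}\to\mathbb{R}$ be smooth functions with $f_i'(t)+1\neq 0$ and $f_i''(t)\neq 0$ for all $t\in\mathbb{R}$ and all $1\le i\le k$. On $\mathbb{R}^{3k+2}$ with coordinates $(u_0,\dots,u_k,v_0,\dots,v_k,s_1,\dots,s_k)$ let $g_F$, $F=(f_1(u_1),\dots,f_k(u_k))$, be the pseudo-Riemannian metric whose only nonzero entries on the coordinate frame are, up to symmetry, $$g_F(\partial_{u_0},\partial_{u_i})=2f_i(u_i)s_i,\quad g_F(\partial_{u_i},\partial_{u_i})=-2u_0s_i,\quad g_F(\partial_{s_i},\partial_{s_i})=\varepsilon_i\quad(1\le i\le k),$$ $$g_F(\partial_{u_a},\partial_{v_a})=1\quad(0\le a\le k),$$ and let $\mathcal{M}_F=(\mathbb{R}^{3k+2},g_F)$. Then $\mathcal{M}_F$ is not $2$-curvature homogeneous: it is not the case that for all points $P,Q$ there is a linear isomorphism $\Phi:T_P\mathcal{M}_F\to T_Q\mathcal{M}_F$ with $\Phi^*g_Q=g_P$ and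 $\Phi^*\nabla^iR_Q=\nabla^iR_P$ for $i=0,1,2$, where $R$ is the Riemann curvature tensor and $\nabla$ the Levi-Civita connection of $g_F$. In particular, $\mathcal{M}_F$ is not locally homogeneous: it is not the case that for all points $P,Q$ there is a smooth isometry from an open neighbourhood of $P$ onto an open neighbourhood of $Q$ which sends $P$ to $Q$. -/

import Mathlib

open scoped ContDiff

noncomputable section

namespace CurvHom

variable {ι : Type} [Fintype ι] [DecidableEq ι]

/-- A smooth pseudo-Riemannian metric on the coordinate space `ℝ^ι`, given by its Gram matrices
with respect to the coordinate frame. -/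
structure PseudoMetric (ι : Type) [Fintype ι] [DecidableEq ι] where
  /-- `gram x i j = g_x(∂_i, ∂_j)` -/
  gram : (ι → ℝ) → Matrix ι ι ℝ
  smooth : ∀ i j, ContDiff ℝ ∞ fun x => gram x i j
  symm : ∀ x i j, gram x i j = gram x j i
  nondegenerate : ∀ x, (gram x).det ≠ 0

/-- The scalar product `g_x(v, w)` of two tangent vectors at the point `x`. -/
def PseudoMetric.inner (g : PseudoMetric ι) (x v w : ι → ℝ) : ℝ :=
  ∑ i, ∑ j, g.gram x i j * v i * w j

/-- The partial derivative `∂_i φ` of a function on `ℝ^ι`. -/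
def partialDeriv (i : ι) (φ : (ι → ℝ) → ℝ) (x : ι → ℝ) : ℝ :=
  fderiv ℝ φ x (Pi.single i 1)

/-- The Christoffel symbol `Γ_{ij}^l` at `x` of the Levi-Civita connection of `g`. -/
def PseudoMetric.christoffel (g : PseudoMetric ι) (x : ι → ℝ) (i j l : ι) : ℝ :=
  (1 / 2) * ∑ m, (g.gram x)⁻¹ l m *
    (partialDeriv i (fun y => g.gram y j m) x + partialDeriv j (fun y => g.gram y i m) x
      - partialDeriv m (fun y => g.gram y i j) x)

/-- The Levi-Civita covariant derivative `∇_X Y` of vector fields on `ℝ^ι`. -/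
def PseudoMetric.nabla (g : PseudoMetric ι) (X Y : (ι → ℝ) → (ι → ℝ)) :
    (ι → ℝ) → (ι → ℝ) :=
  fun x => fderiv ℝ Y x (X x) + fun l => ∑ i, ∑ j, g.christoffel x i j l * X x i * Y x j

/-- The function `R(X,Y,Z,W) = g(∇_X ∇_Y Z - ∇_Y ∇_X Z - ∇_{[X,Y]} Z, W)` of vector fields. -/
def PseudoMetric.curvatureOn (g : PseudoMetric ι) (X Y Z W : (ι → ℝ) → (ι → ℝ))
    (x : ι → ℝ) : ℝ :=
  g.inner x (g.nabla X (g.nabla Y Z) x - g.nabla Y (g.nabla X Z) x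
    - g.nabla (VectorField.lieBracket ℝ X Y) Z x) (W x)

/-- The Riemann curvature tensor at `x`, evaluated on four tangent vectors, which are extended to
constant vector fields. -/
def PseudoMetric.riemann (g : PseudoMetric ι) (x : ι → ℝ) (v : Fin 4 → (ι → ℝ)) : ℝ :=
  g.curvatureOn (fun _ => v 0) (fun _ => v 1) (fun _ => v 2) (fun _ => v 3) x

/-- The covariant derivative of a covariant tensor field `T` of rank `r`:
`(∇T)(v₁, …, v_r; w) = w (T(v₁, …, v_r)) - ∑ₐ T(v₁, …, ∇_w vₐ, …, v_r)`,
where tangent vectors are extended to constant vector fields. The direction of differentiation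
is the last argument. -/
def PseudoMetric.nablaTensor (g : PseudoMetric ι) {r : ℕ}
    (T : (ι → ℝ) → (Fin r → (ι → ℝ)) → ℝ) :
    (ι → ℝ) → (Fin (r + 1) → (ι → ℝ)) → ℝ :=
  fun x v =>
    fderiv ℝ (fun y => T y (fun a => v a.castSucc)) x (v (Fin.last r))
      - ∑ a : Fin r, T x (Function.update (fun b => v b.castSucc) a
          (g.nabla (fun _ => v (Fin.last r)) (fun _ => v a.castSucc) x))

/-- The iterated covariant derivative `∇^i R` of the Riemann curvature tensor. -/
def PseudoMetric.nablaR (g : PseudoMetric ι) :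
    (i : ℕ) → (ι → ℝ) → (Fin (4 + i) → (ι → ℝ)) → ℝ
  | 0 => g.riemann
  | i + 1 => g.nablaTensor (PseudoMetric.nablaR g i)

/-- `(ℝ^ι, g)` is `r`-curvature homogeneous: for any two points `P`, `Q` there is a linear
isomorphism between the tangent spaces that pulls `g_Q` back to `g_P` and `∇^i R_Q` back to
`∇^i R_P` for `i = 0, …, r`. -/
def PseudoMetric.IsCurvatureHomogeneous (g : PseudoMetric ι) (r : ℕ) : Prop :=
  ∀ P Q : ι → ℝ, ∃ Φ : (ι → ℝ) ≃ₗ[ℝ] (ι → ℝ),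
    (∀ v w, g.inner Q (Φ v) (Φ w) = g.inner P v w) ∧
    ∀ i ≤ r, ∀ v : Fin (4 + i) → (ι → ℝ),
      g.nablaR i Q (fun a => Φ (v a)) = g.nablaR i P v

/-- `(ℝ^ι, g)` is locally homogeneous: for any two points `P`, `Q` there is an isometry from an
open neighbourhood of `P` onto an open neighbourhood of `Q` that sends `P` to `Q`. -/
def PseudoMetric.IsLocallyHomogeneous (g : PseudoMetric ι) : Prop :=
  ∀ P Q : ι → ℝ, ∃ φ : OpenPartialHomeomorph (ι → ℝ) (ι → ℝ),
    P ∈ φ.source ∧ φ P = Q ∧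
    ContDiffOn ℝ ∞ φ φ.source ∧ ContDiffOn ℝ ∞ φ.symm φ.target ∧
    ∀ x ∈ φ.source, ∀ v w,
      g.inner (φ x) (fderiv ℝ φ x v) (fderiv ℝ φ x w) = g.inner x v w

/-- Labels of the coordinates `(u_0, …, u_k, v_0, …, v_k, s_1, …, s_k)` on `ℝ^{3k+2}`. -/
abbrev Coord (k : ℕ) : Type := Fin (k + 1) ⊕ Fin (k + 1) ⊕ Fin k

/-- The label of `u_a`, `0 ≤ a ≤ k`. -/
abbrev cu {k : ℕ} (a : Fin (k + 1)) : Coord k := Sum.inl a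

/-- The label of `v_a`, `0 ≤ a ≤ k`. -/
abbrev cv {k : ℕ} (a : Fin (k + 1)) : Coord k := Sum.inr (Sum.inl a)

/-- The label of `s_i`; `i : Fin k` stands for the index `i + 1` in `1, …, k`, and the
corresponding `u`-coordinate is `cu i.succ`. -/
abbrev cs {k : ℕ} (i : Fin k) : Coord k := Sum.inr (Sum.inr i)

/-- The entries `g_F(∂_{u_a}, ∂_{u_b})`. -/
def gramUU {k : ℕ} (f : Fin k → ℝ → ℝ) (x : Coord k → ℝ) (a b : Fin (k + 1)) : ℝ :=
  Fin.cases (motive := fun _ => ℝ)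
    (Fin.cases (motive := fun _ => ℝ) 0 (fun j => 2 * f j (x (cu j.succ)) * x (cs j)) b)
    (fun i => Fin.cases (motive := fun _ => ℝ) (2 * f i (x (cu i.succ)) * x (cs i))
      (fun j => if i = j then -2 * x (cu 0) * x (cs i) else 0) b) a

/-- The Gram matrix of `g_F`, where `F = (f_1(u_1), …, f_k(u_k))`, on the coordinate frame. -/
def gramF {k : ℕ} (ε : Fin k → ℤˣ) (f : Fin k → ℝ → ℝ) (x : Coord k → ℝ) :
    Matrix (Coord k) (Coord k) ℝ
  | .inl a, .inl b => gramUU f x a b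
  | .inl a, .inr (.inl b) => if a = b then 1 else 0
  | .inr (.inl a), .inl b => if a = b then 1 else 0
  | .inr (.inr i), .inr (.inr j) => if i = j then ((ε i : ℤ) : ℝ) else 0
  | _, _ => 0

theorem gramF_smooth {k : ℕ} (ε : Fin k → ℤˣ) (f : Fin k → ℝ → ℝ)
    (hf : ∀ i, ContDiff ℝ ∞ (f i)) (p q : Coord k) :
    ContDiff ℝ ∞ fun x => gramF ε f x p q := by
  have hc : ∀ c : Coord k, ContDiff ℝ ∞ fun x : Coord k → ℝ => x c := fun c =>
    contDiff_apply ℝ ℝ c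
  have hfc : ∀ i, ContDiff ℝ ∞ fun x : Coord k → ℝ => 2 * f i (x (cu i.succ)) * x (cs i) :=
    fun i => (contDiff_const.mul ((hf i).comp (hc _))).mul (hc _)
  rcases p with a | a | i <;> rcases q with b | b | j <;>
    simp only [gramF] <;> try exact contDiff_const
  refine Fin.cases ?_ (fun i => ?_) a <;> refine Fin.cases ?_ (fun j => ?_) b <;>
    simp only [gramUU, Fin.cases_zero, Fin.cases_succ]
  · exact contDiff_const
  · exact hfc j
  · exact hfc i
  · split_ifs
    · exact (contDiff_const.mul (hc _)).mul (hc _)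
    · exact contDiff_const

theorem gramF_symm {k : ℕ} (ε : Fin k → ℤˣ) (f : Fin k → ℝ → ℝ) (x : Coord k → ℝ)
    (p q : Coord k) : gramF ε f x p q = gramF ε f x q p := by
  rcases p with a | a | i <;> rcases q with b | b | j <;> simp only [gramF]
  · refine Fin.cases ?_ (fun i => ?_) a <;> refine Fin.cases ?_ (fun j => ?_) b <;>
      simp only [gramUU, Fin.cases_zero, Fin.cases_succ]
    by_cases h : i = j
    · subst h; rfl
    · rw [if_neg h, if_neg (Ne.symm h)]
  · simp only [eq_comm]
  · simp only [eq_comm]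
  · by_cases h : i = j
    · subst h; rfl
    · rw [if_neg h, if_neg (Ne.symm h)]

theorem gramF_nondegenerate {k : ℕ} (ε : Fin k → ℤˣ) (f : Fin k → ℝ → ℝ) (x : Coord k → ℝ) :
    (gramF ε f x).det ≠ 0 := by
  intro h
  obtain ⟨w, hw, hz⟩ := Matrix.exists_mulVec_eq_zero_iff.mpr h
  have hu : ∀ a, w (cu a) = 0 := fun a => by
    have := congrFun hz (cv a)
    simpa [Matrix.mulVec, dotProduct, Fintype.sum_sum_type, gramF] using this
  have hs : ∀ i, w (cs i) = 0 := fun i => by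
    have := congrFun hz (cs i)
    simpa [Matrix.mulVec, dotProduct, Fintype.sum_sum_type, gramF] using this
  have hv : ∀ a, w (cv a) = 0 := fun a => by
    have := congrFun hz (cu a)
    simpa [Matrix.mulVec, dotProduct, Fintype.sum_sum_type, gramF, hu] using this
  apply hw
  funext p
  rcases p with a | a | i
  exacts [hu a, hv a, hs i]

/-- The pseudo-Riemannian manifold `M_F = (ℝ^{3k+2}, g_F)`. -/
def metricF {k : ℕ} (ε : Fin k → ℤˣ) (f : Fin k → ℝ → ℝ) (hf : ∀ i, ContDiff ℝ ∞ (f i)) :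
    PseudoMetric (Coord k) where
  gram := gramF ε f
  smooth := gramF_smooth ε f hf
  symm := gramF_symm ε f
  nondegenerate := gramF_nondegenerate ε f

end CurvHom

end

/-!
Local homogeneity implies curvature homogeneity of every order: the differential of a local
isometry `φ` matches the metrics, and the transformation law
`dφ(∇_v w) = d²φ(v, w) + ∇_{dφ v} dφ w` of the Christoffel symbols, which follows from the Koszul
formula, shows that it matches `R` and, by induction, every `∇^i R`
(`PseudoMetric.IsLocallyHomogeneous.isCurvatureHomogeneous`). So it suffices to refute
`2`-curvature homogeneity.

For `g_F` one finds, with `h_i = f_i' + 1`,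
`∇^m R = ∑ i, (h_i^(m) A_i + q_{i,m} B_i) ⊗ du_i^m` (`metricF_nablaR`), where `A_i` and `B_i` are
the algebraic curvature tensors with `A_i(∂u_0, ∂u_i, ∂u_i, ∂s_i) = 1` and
`B_i(∂u_0, ∂u_i, ∂u_i, ∂u_0) = 1`, and `q_{i,0} = ε_i f_i²`,
`q_{i,m+1} = q_{i,m}' + 2 ε_i f_i h_i^(m)`. A linear isomorphism `T_P → T_Q` that preserves the
metric, `R`, `∇R` and `∇²R` preserves the kernel of `R`, its orthogonal complement, and the common
kernel of `du_1, …, du_k`. Comparing the components that remain shows that for each index `a` there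
is an index `j` such that the quantities `h h'' / h'²` and `h' (h q₁ - h' q₀) / h⁴`, taken for `a`
at `P` and for `j` at `Q`, agree (`IsModelIso.exists_invariant_eq`).

Fix `Q` and let `u_a(P) = t` vary: both quantities take finitely many values, hence are constant in
`t`. If `h h'' / h'² = κ`, then `h / h'` is affine of slope `1 - κ` and has no zero, so `κ = 1` and
`h = a e^{bt}`. Then `b f = h - b t + const`, and constancy of the second quantity reads
`b f (4 h - 2 - b f) = const * h²`; as `b t → -∞`, the left side tends to `-∞` and the right side
to `0` (`not_const_invariants`).
-/

noncomputable section

namespace CurvHom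

/-! ### The Koszul formula -/

section

/-- `ContDiff.smul_const` over `ℝ`, for an abstract normed space `F`: applied to a space of bilinear
maps directly, that lemma fails to find its `IsBoundedSMul` instance. -/
theorem contDiff_smul_vec {E F : Type*} [NormedAddCommGroup E] [NormedSpace ℝ E]
    [NormedAddCommGroup F] [NormedSpace ℝ F] {c : E → ℝ} (hc : ContDiff ℝ ∞ c) (A : F) :
    ContDiff ℝ ∞ fun x => c x • A :=
  hc.smul_const A

theorem contDiff_matrix_det {E n : Type*} [NormedAddCommGroup E] [NormedSpace ℝ E]
    [Fintype n] [DecidableEq n] {A : E → Matrix n n ℝ}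
    (hA : ∀ i j, ContDiff ℝ ∞ fun x => A x i j) : ContDiff ℝ ∞ fun x => (A x).det := by
  simp only [Matrix.det_apply]
  refine ContDiff.sum fun σ _ => ?_
  simp only [Units.smul_def, zsmul_eq_mul]
  exact contDiff_const.mul (contDiff_prod fun i _ => hA _ _)

theorem induction_on_single {ι : Type} [Fintype ι] [DecidableEq ι] {p : (ι → ℝ) → Prop}
    (add : ∀ v w, p v → p w → p (v + w)) (smul : ∀ (c : ℝ) v, p v → p (c • v))
    (zero : p 0) (single : ∀ i, p (Pi.single i 1)) (v : ι → ℝ) : p v := by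
  rw [← Finset.univ_sum_single v]
  refine Finset.sum_induction _ p add zero fun i _ => ?_
  have : (Pi.single i (v i) : ι → ℝ) = v i • Pi.single i 1 := by
    rw [← Pi.single_smul, smul_eq_mul, mul_one]
  rw [this]
  exact smul _ _ (single i)

namespace PseudoMetric

variable {ι : Type} [Fintype ι] [DecidableEq ι] (g : PseudoMetric ι)

/-- The metric as a field of continuous bilinear forms. -/
def form (x : ι → ℝ) : (ι → ℝ) →L[ℝ] (ι → ℝ) →L[ℝ] ℝ :=
  ∑ i, ∑ j, g.gram x i j • (ContinuousLinearMap.proj (R := ℝ) (φ := fun _ : ι => ℝ) i).smulRight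
    (ContinuousLinearMap.proj (R := ℝ) (φ := fun _ : ι => ℝ) j)

theorem form_apply (x v w : ι → ℝ) : g.form x v w = g.inner x v w := by
  simp [form, inner, mul_assoc]

theorem form_smooth : ContDiff ℝ ∞ g.form := by
  unfold form
  exact ContDiff.sum fun i _ => ContDiff.sum fun j _ =>
    contDiff_smul_vec (g.smooth i j) _

theorem form_symm (x v w : ι → ℝ) : g.form x v w = g.form x w v := by
  rw [form_apply, form_apply, inner, inner, Finset.sum_comm]
  exact Finset.sum_congr rfl fun i _ => Finset.sum_congr rfl fun j _ => by
    rw [g.symm x j i]; ring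

theorem eq_of_form_eq {x v w : ι → ℝ} (h : ∀ z, g.form x v z = g.form x w z) : v = w := by
  have h0 : Matrix.mulVec (g.gram x) (v - w) = 0 := by
    funext j
    have := h (Pi.single j 1)
    rw [← sub_eq_zero, ← sub_apply, ← map_sub, form_apply, inner] at this
    simpa [Matrix.mulVec, dotProduct, Pi.single_apply, g.symm x j] using this
  by_contra hne
  exact g.nondegenerate x
    (Matrix.exists_mulVec_eq_zero_iff.mp ⟨v - w, sub_ne_zero.mpr hne, h0⟩)

theorem fderiv_form_apply (x v w z : ι → ℝ) :
    fderiv ℝ (fun y => g.inner y w z) x v = fderiv ℝ g.form x v w z := by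
  have hd : HasFDerivAt g.form (fderiv ℝ g.form x) x :=
    (g.form_smooth.differentiable (by simp) x).hasFDerivAt
  have := ((hd.clm_apply (hasFDerivAt_const w x)).clm_apply (hasFDerivAt_const z x)).fderiv
  simp only [form_apply] at this
  rw [this]
  simp

theorem fderiv_form_single (x : ι → ℝ) (i j m : ι) :
    fderiv ℝ g.form x (Pi.single i 1) (Pi.single j 1) (Pi.single m 1)
      = partialDeriv i (fun y => g.gram y j m) x := by
  rw [← fderiv_form_apply, partialDeriv]
  congr 2
  funext y
  simp [inner, Pi.single_apply]

/-- The Christoffel symbols as a field of continuous bilinear maps, `conn x v w = ∇_v w` for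
constant vector fields `v` and `w`. -/
def conn (x : ι → ℝ) : (ι → ℝ) →L[ℝ] (ι → ℝ) →L[ℝ] (ι → ℝ) :=
  ∑ i, ∑ j, (ContinuousLinearMap.proj (R := ℝ) (φ := fun _ : ι => ℝ) i).smulRight
    ((ContinuousLinearMap.proj (R := ℝ) (φ := fun _ : ι => ℝ) j).smulRight
      (fun l => g.christoffel x i j l))

theorem conn_apply (x v w : ι → ℝ) (l : ι) :
    g.conn x v w l = ∑ i, ∑ j, g.christoffel x i j l * v i * w j := by
  simp only [conn, sum_apply, Finset.sum_apply]
  refine Finset.sum_congr rfl fun i _ => Finset.sum_congr rfl fun j _ => ?_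
  simp; ring

theorem nabla_eq (X Y : (ι → ℝ) → (ι → ℝ)) (x : ι → ℝ) :
    g.nabla X Y x = fderiv ℝ Y x (X x) + g.conn x (X x) (Y x) := by
  rw [nabla]
  congr 1
  funext l
  rw [conn_apply]

theorem nabla_const (x v w : ι → ℝ) : g.nabla (fun _ => v) (fun _ => w) x = g.conn x v w := by
  rw [nabla_eq]; simp

theorem gram_inv_smooth (i j : ι) : ContDiff ℝ ∞ fun x => (g.gram x)⁻¹ i j := by
  have h : (fun x => (g.gram x)⁻¹ i j)
      = fun x => ((g.gram x).det)⁻¹ * ((g.gram x).updateRow j (Pi.single i 1)).det := by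
    funext x
    rw [Matrix.inv_def, Ring.inverse_eq_inv', Matrix.smul_apply, Matrix.adjugate_apply,
      smul_eq_mul]
  rw [h]
  refine ((contDiff_matrix_det g.smooth).inv g.nondegenerate).mul (contDiff_matrix_det ?_)
  intro a b
  by_cases hab : a = j
  · subst hab
    simp only [Matrix.updateRow_self]
    exact contDiff_const
  · simp only [Matrix.updateRow_ne hab]
    exact g.smooth a b

theorem contDiff_partialDeriv {φ : (ι → ℝ) → ℝ} (hφ : ContDiff ℝ ∞ φ) (i : ι) :
    ContDiff ℝ ∞ (partialDeriv i φ) :=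
  (hφ.fderiv_right (by simp)).clm_apply contDiff_const

theorem christoffel_smooth (i j l : ι) : ContDiff ℝ ∞ fun x => g.christoffel x i j l :=
  contDiff_const.mul <| ContDiff.sum fun m _ => (g.gram_inv_smooth l m).mul <|
    ((contDiff_partialDeriv (g.smooth j m) i).add (contDiff_partialDeriv (g.smooth i m) j)).sub
      (contDiff_partialDeriv (g.smooth i j) m)

theorem conn_smooth : ContDiff ℝ ∞ g.conn := by
  unfold conn
  refine ContDiff.sum fun i _ => ContDiff.sum fun j _ => ?_
  refine contDiff_const.smulRight (contDiff_const.smulRight ?_)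
  exact contDiff_pi.mpr fun l => g.christoffel_smooth i j l

/-- The Christoffel symbols of the second kind, lowered by the metric. -/
theorem sum_gram_mul_christoffel (x : ι → ℝ) (i j m : ι) :
    ∑ l, g.gram x l m * g.christoffel x i j l
      = (1 / 2) * (partialDeriv i (fun y => g.gram y j m) x
        + partialDeriv j (fun y => g.gram y i m) x
        - partialDeriv m (fun y => g.gram y i j) x) := by
  set K : ι → ℝ := fun m => partialDeriv i (fun y => g.gram y j m) x
        + partialDeriv j (fun y => g.gram y i m) x
        - partialDeriv m (fun y => g.gram y i j) x with hK
  have h1 : g.gram x * (g.gram x)⁻¹ = 1 :=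
    Matrix.mul_nonsing_inv _ (isUnit_iff_ne_zero.mpr (g.nondegenerate x))
  have h2 : Matrix.mulVec (g.gram x) (Matrix.mulVec (g.gram x)⁻¹ K) = K := by
    rw [Matrix.mulVec_mulVec, h1, Matrix.one_mulVec]
  have h3 := congrFun h2 m
  change _ = 1 / 2 * K m
  rw [← h3, Matrix.mulVec, dotProduct, Finset.mul_sum]
  refine Finset.sum_congr rfl fun l _ => ?_
  rw [christoffel, g.symm x l m]
  change _ * (1 / 2 * (Matrix.mulVec (g.gram x)⁻¹ K l)) = _
  ring

/-- The Koszul formula on constant vector fields. -/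
theorem two_mul_form_conn (x v w z : ι → ℝ) :
    2 * g.form x (g.conn x v w) z
      = fderiv ℝ g.form x v w z + fderiv ℝ g.form x w v z - fderiv ℝ g.form x z v w := by
  -- Both sides are trilinear in `v`, `w`, `z`, so it suffices to compare them on the frame.
  have hL : ∀ i j m, 2 * g.form x (g.conn x (Pi.single i 1) (Pi.single j 1)) (Pi.single m 1)
      = fderiv ℝ g.form x (Pi.single i 1) (Pi.single j 1) (Pi.single m 1)
        + fderiv ℝ g.form x (Pi.single j 1) (Pi.single i 1) (Pi.single m 1)
        - fderiv ℝ g.form x (Pi.single m 1) (Pi.single i 1) (Pi.single j 1) := by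
    intro i j m
    rw [fderiv_form_single, fderiv_form_single, fderiv_form_single]
    have h := g.sum_gram_mul_christoffel x i j m
    have h2 : g.form x (g.conn x (Pi.single i 1) (Pi.single j 1)) (Pi.single m 1)
        = ∑ l, g.gram x l m * g.christoffel x i j l := by
      rw [form_apply, inner]
      simp [conn_apply, Pi.single_apply]
    rw [h2, h]; ring
  induction v using induction_on_single with
  | add a b h h' => simp only [map_add, add_apply, mul_add, h, h']; ring
  | smul c a h => simp only [map_smul, smul_apply, smul_eq_mul]; linear_combination c * h
  | zero => simp
  | single i =>
    induction w using induction_on_single with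
    | add a b h h' => simp only [map_add, add_apply, mul_add, h, h']; ring
    | smul c a h => simp only [map_smul, smul_apply, smul_eq_mul]; linear_combination c * h
    | zero => simp
    | single j =>
      induction z using induction_on_single with
      | add a b h h' => simp only [map_add, add_apply, mul_add, h, h']; ring
      | smul c a h => simp only [map_smul, smul_apply, smul_eq_mul]; linear_combination c * h
      | zero => simp
      | single m =>
        exact hL i j m

end PseudoMetric

end

/-! ### Naturality of the connection and of the curvature -/

section

namespace PseudoMetric

variable {ι : Type} [Fintype ι] [DecidableEq ι] (g : PseudoMetric ι)

theorem hasFDerivAt_form (x : ι → ℝ) : HasFDerivAt g.form (fderiv ℝ g.form x) x :=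
  (g.form_smooth.differentiable (by simp) x).hasFDerivAt

theorem hasFDerivAt_conn (x : ι → ℝ) : HasFDerivAt g.conn (fderiv ℝ g.conn x) x :=
  (g.conn_smooth.differentiable (by simp) x).hasFDerivAt

theorem fderiv_conn_const_apply (x u w z : ι → ℝ) :
    fderiv ℝ (fun y => g.conn y u w) x z = fderiv ℝ g.conn x z u w := by
  rw [(((g.hasFDerivAt_conn x).clm_apply (hasFDerivAt_const u x)).clm_apply
    (hasFDerivAt_const w x)).fderiv]
  simp

/-- The curvature operator `R(u, v) w` expressed by the Christoffel symbols. -/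
def curvatureVector (x u v w : ι → ℝ) : ι → ℝ :=
  fderiv ℝ g.conn x u v w - fderiv ℝ g.conn x v u w
    + g.conn x u (g.conn x v w) - g.conn x v (g.conn x u w)

theorem riemann_eq (x : ι → ℝ) (v : Fin 4 → (ι → ℝ)) :
    g.riemann x v = g.form x (g.curvatureVector x (v 0) (v 1) (v 2)) (v 3) := by
  have h : ∀ u w : ι → ℝ, g.nabla (fun _ => u) (fun _ => w) = fun y => g.conn y u w :=
    fun u w => funext fun y => g.nabla_const y u w
  have hz : VectorField.lieBracket ℝ (fun _ => v 0) (fun _ => v 1) = fun _ : ι → ℝ => 0 := by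
    funext y; simp [VectorField.lieBracket]
  rw [riemann, curvatureOn, hz, h, h, nabla_eq, nabla_eq, fderiv_conn_const_apply,
    fderiv_conn_const_apply, nabla_eq, form_apply, curvatureVector]
  congr 1
  simp
  abel

/-- `φ` is a smooth map on the open set `U` that pulls the metric `h` back to `g`. -/
structure IsIsometryOn (h : PseudoMetric ι) (φ : (ι → ℝ) → (ι → ℝ)) (U : Set (ι → ℝ)) : Prop where
  isOpen : IsOpen U
  contDiffOn : ContDiffOn ℝ ∞ φ U
  form_fderiv : ∀ x ∈ U, ∀ v w,
    h.form (φ x) (fderiv ℝ φ x v) (fderiv ℝ φ x w) = g.form x v w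

namespace IsIsometryOn

variable {g} {h : PseudoMetric ι} {φ : (ι → ℝ) → (ι → ℝ)} {U : Set (ι → ℝ)}
  (H : g.IsIsometryOn h φ U) {x : ι → ℝ} (hx : x ∈ U)

include H hx

theorem contDiffAt : ContDiffAt ℝ ∞ φ x := H.contDiffOn.contDiffAt (H.isOpen.mem_nhds hx)

theorem contDiffAt_fderiv : ContDiffAt ℝ ∞ (fderiv ℝ φ) x :=
  (H.contDiffAt hx).fderiv_right (by simp)

theorem contDiffAt_fderiv_two : ContDiffAt ℝ ∞ (fderiv ℝ (fderiv ℝ φ)) x :=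
  (H.contDiffAt_fderiv hx).fderiv_right (by simp)

theorem hasFDerivAt : HasFDerivAt φ (fderiv ℝ φ x) x :=
  ((H.contDiffAt hx).differentiableAt (by simp)).hasFDerivAt

theorem hasFDerivAt_two : HasFDerivAt (fderiv ℝ φ) (fderiv ℝ (fderiv ℝ φ) x) x :=
  ((H.contDiffAt_fderiv hx).differentiableAt (by simp)).hasFDerivAt

theorem hasFDerivAt_three :
    HasFDerivAt (fderiv ℝ (fderiv ℝ φ)) (fderiv ℝ (fderiv ℝ (fderiv ℝ φ)) x) x :=
  ((H.contDiffAt_fderiv_two hx).differentiableAt (by simp)).hasFDerivAt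

theorem fderiv_two_symm (v w : ι → ℝ) :
    fderiv ℝ (fderiv ℝ φ) x v w = fderiv ℝ (fderiv ℝ φ) x w v :=
  ((H.contDiffAt hx).isSymmSndFDerivAt (by simpa using ENat.LEInfty.out)) v w

theorem fderiv_three_symm (u v w : ι → ℝ) :
    fderiv ℝ (fderiv ℝ (fderiv ℝ φ)) x u v w = fderiv ℝ (fderiv ℝ (fderiv ℝ φ)) x v u w :=
  congrArg (fun L : (ι → ℝ) →L[ℝ] (ι → ℝ) => L w)
    (((H.contDiffAt_fderiv hx).isSymmSndFDerivAt (by simpa using ENat.LEInfty.out)) u v)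

theorem injective_fderiv : Function.Injective (fderiv ℝ φ x) := by
  intro v w hvw
  refine g.eq_of_form_eq (x := x) fun z => ?_
  rw [← H.form_fderiv x hx, ← H.form_fderiv x hx, hvw]

theorem surjective_fderiv : Function.Surjective (fderiv ℝ φ x) :=
  (LinearMap.injective_iff_surjective
    (f := (fderiv ℝ φ x : (ι → ℝ) →ₗ[ℝ] (ι → ℝ)))).mp (H.injective_fderiv hx)

/-- The derivative of the identity `h(dφ v, dφ w) = g(v, w)`. -/
theorem fderiv_form (u v w : ι → ℝ) :
    fderiv ℝ g.form x u v w
      = fderiv ℝ h.form (φ x) (fderiv ℝ φ x u) (fderiv ℝ φ x v) (fderiv ℝ φ x w)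
        + h.form (φ x) (fderiv ℝ (fderiv ℝ φ) x u v) (fderiv ℝ φ x w)
        + h.form (φ x) (fderiv ℝ φ x v) (fderiv ℝ (fderiv ℝ φ) x u w) := by
  have hv := (H.hasFDerivAt_two hx).clm_apply (hasFDerivAt_const v x)
  have hw := (H.hasFDerivAt_two hx).clm_apply (hasFDerivAt_const w x)
  have hc : HasFDerivAt (fun y => h.form (φ y)) (fderiv ℝ h.form (φ x) ∘L fderiv ℝ φ x) x :=
    HasFDerivAt.comp (g := h.form) (f := φ) x (h.hasFDerivAt_form (φ x)) (H.hasFDerivAt hx)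
  have h1 := (hc.clm_apply hv).clm_apply hw
  have h2 := ((g.hasFDerivAt_form x).clm_apply (hasFDerivAt_const v x)).clm_apply
    (hasFDerivAt_const w x)
  have h3 : (fun y => g.form y v w) =ᶠ[nhds x]
      fun y => h.form (φ y) (fderiv ℝ φ y v) (fderiv ℝ φ y w) := by
    filter_upwards [H.isOpen.mem_nhds hx] with y hy
    rw [H.form_fderiv y hy]
  have h4 := congrArg (fun L : (ι → ℝ) →L[ℝ] ℝ => L u) ((h1.congr_of_eventuallyEq h3).unique h2)
  simp at h4
  rw [← h4]
  ring

/-- The transformation law of the Christoffel symbols. -/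
theorem fderiv_conn_apply (v w : ι → ℝ) :
    fderiv ℝ φ x (g.conn x v w)
      = fderiv ℝ (fderiv ℝ φ) x v w + h.conn (φ x) (fderiv ℝ φ x v) (fderiv ℝ φ x w) := by
  refine h.eq_of_form_eq (x := φ x) fun z' => ?_
  obtain ⟨z, rfl⟩ := H.surjective_fderiv hx z'
  have k1 := g.two_mul_form_conn x v w z
  have k2 := h.two_mul_form_conn (φ x) (fderiv ℝ φ x v) (fderiv ℝ φ x w) (fderiv ℝ φ x z)
  rw [H.fderiv_form hx, H.fderiv_form hx, H.fderiv_form hx, H.fderiv_two_symm hx w v,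
    H.fderiv_two_symm hx z v, H.fderiv_two_symm hx z w] at k1
  rw [H.form_fderiv x hx, map_add, add_apply]
  rw [h.form_symm _ (fderiv ℝ φ x w), h.form_symm _ (fderiv ℝ φ x v)] at k1
  linarith [h.form_symm (φ x) (fderiv ℝ φ x w) (fderiv ℝ (fderiv ℝ φ) x v z)]

/-- The derivative of the transformation law of the Christoffel symbols. -/
theorem fderiv_fderiv_conn (u v w : ι → ℝ) :
    fderiv ℝ (fderiv ℝ φ) x u (g.conn x v w) + fderiv ℝ φ x (fderiv ℝ g.conn x u v w)
      = fderiv ℝ (fderiv ℝ (fderiv ℝ φ)) x u v w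
        + fderiv ℝ h.conn (φ x) (fderiv ℝ φ x u) (fderiv ℝ φ x v) (fderiv ℝ φ x w)
        + h.conn (φ x) (fderiv ℝ (fderiv ℝ φ) x u v) (fderiv ℝ φ x w)
        + h.conn (φ x) (fderiv ℝ φ x v) (fderiv ℝ (fderiv ℝ φ) x u w) := by
  have h0 := ((H.hasFDerivAt_three hx).clm_apply (hasFDerivAt_const v x)).clm_apply
    (hasFDerivAt_const w x)
  have hv := (H.hasFDerivAt_two hx).clm_apply (hasFDerivAt_const v x)
  have hw := (H.hasFDerivAt_two hx).clm_apply (hasFDerivAt_const w x)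
  have hc : HasFDerivAt (fun y => h.conn (φ y)) (fderiv ℝ h.conn (φ x) ∘L fderiv ℝ φ x) x :=
    HasFDerivAt.comp (g := h.conn) (f := φ) x (h.hasFDerivAt_conn (φ x)) (H.hasFDerivAt hx)
  have h1 := (hc.clm_apply hv).clm_apply hw
  have h2 := (H.hasFDerivAt_two hx).clm_apply
    (((g.hasFDerivAt_conn x).clm_apply (hasFDerivAt_const v x)).clm_apply
    (hasFDerivAt_const w x))
  have h3 : (fun y => fderiv ℝ φ y (g.conn y v w)) =ᶠ[nhds x]
      fun y => fderiv ℝ (fderiv ℝ φ) y v w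
        + h.conn (φ y) (fderiv ℝ φ y v) (fderiv ℝ φ y w) := by
    filter_upwards [H.isOpen.mem_nhds hx] with y hy
    exact H.fderiv_conn_apply hy v w
  have h4 := congrArg (fun L : (ι → ℝ) →L[ℝ] (ι → ℝ) => L u)
    (((h0.add h1).congr_of_eventuallyEq h3).unique h2)
  simp at h4
  rw [add_comm, ← h4]
  abel

/-- The curvature tensor is natural under local isometries: in the antisymmetrization of
`fderiv_fderiv_conn` the third derivative of `φ` cancels. -/
theorem riemann_eq (v : Fin 4 → (ι → ℝ)) :
    h.riemann (φ x) (fun a => fderiv ℝ φ x (v a)) = g.riemann x v := by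
  have key : ∀ u v w, fderiv ℝ φ x (g.curvatureVector x u v w)
      = h.curvatureVector (φ x) (fderiv ℝ φ x u) (fderiv ℝ φ x v) (fderiv ℝ φ x w) := by
    intro u v w
    have e1 := H.fderiv_fderiv_conn hx u v w
    have e2 := H.fderiv_fderiv_conn hx v u w
    rw [H.fderiv_three_symm hx v u, H.fderiv_two_symm hx v u] at e2
    have e3 := eq_sub_of_add_eq' e1
    have e4 := eq_sub_of_add_eq' e2
    simp only [curvatureVector, map_add, map_sub, H.fderiv_conn_apply hx]
    rw [e3, e4]
    abel
  rw [PseudoMetric.riemann_eq, PseudoMetric.riemann_eq, ← key, H.form_fderiv x hx]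

end IsIsometryOn

end PseudoMetric

end

/-! ### Smooth tensor fields and naturality of `∇^i R` -/

section

variable {ι : Type} [Fintype ι] [DecidableEq ι]

/-- `T` is a smooth covariant tensor field of rank `r` on `ℝ^ι`: it is given by a smooth field of
continuous multilinear forms. -/
def IsSmoothTensor {r : ℕ} (T : (ι → ℝ) → (Fin r → (ι → ℝ)) → ℝ) : Prop :=
  ∃ M : (ι → ℝ) → ContinuousMultilinearMap ℝ (fun _ : Fin r => ι → ℝ) ℝ,
    ContDiff ℝ ∞ M ∧ ∀ x v, T x v = M x v

theorem multilinear_expansion {r : ℕ} (m : MultilinearMap ℝ (fun _ : Fin r => ι → ℝ) ℝ)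
    (v : Fin r → (ι → ℝ)) :
    m v = ∑ I : Fin r → ι, m (fun a => Pi.single (I a) 1) * ∏ a, v a (I a) := by
  have h : v = fun a => ∑ i, v a i • (Pi.single i 1 : ι → ℝ) := by
    funext a
    conv_lhs => rw [← Finset.univ_sum_single (v a)]
    refine Finset.sum_congr rfl fun i _ => ?_
    rw [← Pi.single_smul, smul_eq_mul, mul_one]
  conv_lhs => rw [h, MultilinearMap.map_sum]
  refine Finset.sum_congr rfl fun I _ => ?_
  rw [MultilinearMap.map_smul_univ, smul_eq_mul, mul_comm]

/-- The elementary tensor `v ↦ ∏ₐ vₐ(I a)`. -/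
def coordTensor {r : ℕ} (I : Fin r → ι) :
    ContinuousMultilinearMap ℝ (fun _ : Fin r => ι → ℝ) ℝ :=
  (ContinuousMultilinearMap.mkPiAlgebra ℝ (Fin r) ℝ).compContinuousLinearMap
    fun a => ContinuousLinearMap.proj (R := ℝ) (φ := fun _ : ι => ℝ) (I a)

omit [Fintype ι] [DecidableEq ι] in
theorem coordTensor_apply {r : ℕ} (I : Fin r → ι) (v : Fin r → (ι → ℝ)) :
    coordTensor I v = ∏ a, v a (I a) := by
  simp [coordTensor]

/-- A field of multilinear forms is smooth as soon as its values on constant vectors are. -/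
theorem IsSmoothTensor.of_multilinear {r : ℕ} {T : (ι → ℝ) → (Fin r → (ι → ℝ)) → ℝ}
    (m : (ι → ℝ) → MultilinearMap ℝ (fun _ : Fin r => ι → ℝ) ℝ) (hm : ∀ x v, T x v = m x v)
    (hT : ∀ v, ContDiff ℝ ∞ fun x => T x v) : IsSmoothTensor T := by
  refine ⟨fun x => ∑ I : Fin r → ι, T x (fun a => Pi.single (I a) 1) • coordTensor I, ?_, ?_⟩
  · exact ContDiff.sum fun I _ => contDiff_smul_vec (hT _) _
  · intro x v
    rw [hm, multilinear_expansion]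
    simp [coordTensor_apply, hm]

/-- A smooth tensor field has smooth values on smooth vector fields. -/
theorem IsSmoothTensor.contDiff_apply {r : ℕ} {T : (ι → ℝ) → (Fin r → (ι → ℝ)) → ℝ}
    (hT : IsSmoothTensor T) {u : Fin r → (ι → ℝ) → (ι → ℝ)} (hu : ∀ a, ContDiff ℝ ∞ (u a)) :
    ContDiff ℝ ∞ fun x => T x fun a => u a x := by
  obtain ⟨M, hM, hTM⟩ := hT
  have h : (fun x => T x fun a => u a x) = fun x => ∑ I : Fin r → ι,
      M x (fun a => Pi.single (I a) 1) * ∏ a, u a x (I a) := by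
    funext x
    rw [hTM]
    exact multilinear_expansion (M x).toMultilinearMap _
  rw [h]
  refine ContDiff.sum fun I _ => ContDiff.mul ?_ ?_
  · exact (ContinuousMultilinearMap.apply ℝ (fun _ : Fin r => ι → ℝ) ℝ
      (fun a => Pi.single (I a) 1)).contDiff.comp hM
  · exact contDiff_prod fun a _ => contDiff_pi.mp (hu a) (I a)

namespace PseudoMetric

variable (g : PseudoMetric ι)

theorem curvatureVector_smooth {u v w : ι → ℝ} :
    ContDiff ℝ ∞ fun x => g.curvatureVector x u v w := by
  have h := g.conn_smooth
  have hc : ∀ {a b : (ι → ℝ) → (ι → ℝ)}, ContDiff ℝ ∞ a → ContDiff ℝ ∞ b →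
    ContDiff ℝ ∞ fun x => g.conn x (a x) (b x) := fun ha hb => (h.clm_apply ha).clm_apply hb
  have hd : ∀ a b c : ι → ℝ, ContDiff ℝ ∞ fun x => fderiv ℝ g.conn x a b c := fun a b c => by
    simp only [← fderiv_conn_const_apply]
    exact ((hc (a := fun _ => b) (b := fun _ => c) contDiff_const contDiff_const).fderiv_right
      (by simp)).clm_apply contDiff_const
  have k : ∀ c : ι → ℝ, ContDiff ℝ ∞ fun _ : ι → ℝ => c := fun c => contDiff_const
  exact (((hd u v w).sub (hd v u w)).add (hc (k u) (hc (k v) (k w)))).sub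
    (hc (k v) (hc (k u) (k w)))

theorem isSmoothTensor_riemann : IsSmoothTensor g.riemann := by
  refine IsSmoothTensor.of_multilinear
    (fun x => MultilinearMap.mk' (fun v : Fin 4 → (ι → ℝ) =>
      g.form x (g.curvatureVector x (v 0) (v 1) (v 2)) (v 3)) ?_ ?_)
    (fun x v => g.riemann_eq x v) fun v => ?_
  · intro v a u w
    fin_cases a <;> simp [curvatureVector] <;> ring
  · intro v a c w
    fin_cases a <;> simp [curvatureVector] <;> ring
  · simp only [riemann_eq]
    exact (g.form_smooth.clm_apply g.curvatureVector_smooth).clm_apply contDiff_const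

theorem nablaTensor_eq {r : ℕ} {T : (ι → ℝ) → (Fin r → (ι → ℝ)) → ℝ}
    {M : (ι → ℝ) → ContinuousMultilinearMap ℝ (fun _ : Fin r => ι → ℝ) ℝ}
    (hM : ContDiff ℝ ∞ M) (hTM : ∀ x v, T x v = M x v) (x : ι → ℝ)
    (v : Fin (r + 1) → (ι → ℝ)) :
    g.nablaTensor T x v = fderiv ℝ M x (v (Fin.last r)) (fun a => v a.castSucc)
      - ∑ a, M x (Function.update (fun b => v b.castSucc) a
          (g.conn x (v (Fin.last r)) (v a.castSucc))) := by
  have h : HasFDerivAt M (fderiv ℝ M x) x := (hM.differentiable (by simp) x).hasFDerivAt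
  simp only [nablaTensor, hTM, nabla_const]
  rw [(h.continuousMultilinear_apply_const _).fderiv]
  rfl

theorem isSmoothTensor_nablaTensor {r : ℕ} {T : (ι → ℝ) → (Fin r → (ι → ℝ)) → ℝ}
    (hT : IsSmoothTensor T) : IsSmoothTensor (g.nablaTensor T) := by
  obtain ⟨M, hM, hTM⟩ := id hT
  refine IsSmoothTensor.of_multilinear
    (fun x => (ContinuousLinearMap.flipMultilinear (fderiv ℝ M x -
      ((M x).fderivCompContinuousLinearMap fun _ => ContinuousLinearMap.id ℝ (ι → ℝ)) ∘L
        (ContinuousLinearMap.pi fun _ => g.conn x))).uncurryRight.toMultilinearMap)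
    (fun x v => ?_) fun v => ?_
  · rw [g.nablaTensor_eq hM hTM]
    simp
    refine congrArg₂ _ rfl (Finset.sum_congr rfl fun a _ => congrArg _ (funext fun b => ?_))
    by_cases hb : b = a
    · subst hb; simp [Fin.init]
    · simp [hb, Fin.init]
  · simp only [PseudoMetric.nablaTensor, nabla_const]
    refine ContDiff.sub ?_ (ContDiff.sum fun a _ => ?_)
    · exact ((hT.contDiff_apply (u := fun a _ => v a.castSucc) fun _ => contDiff_const).fderiv_right
        (by simp)).clm_apply contDiff_const
    · have := hT.contDiff_apply (u := fun b x => Function.update (fun b => v b.castSucc) a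
          (g.conn x (v (Fin.last r)) (v a.castSucc)) b) fun b => ?_
      · exact this
      · by_cases hb : b = a
        · subst hb
          simp only [Function.update_self]
          exact (g.conn_smooth.clm_apply contDiff_const).clm_apply contDiff_const
        · simp only [Function.update_of_ne hb]
          exact contDiff_const

theorem isSmoothTensor_nablaR : ∀ i, IsSmoothTensor (g.nablaR i)
  | 0 => g.isSmoothTensor_riemann
  | i + 1 => isSmoothTensor_nablaTensor g (isSmoothTensor_nablaR i)

/-- If a local isometry relates two tensor fields, then it relates their covariant derivatives: the
second derivatives of `φ` that the product rule yields are those in the transformation law of the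
Christoffel symbols. -/
theorem IsIsometryOn.nablaTensor_eq {g h : PseudoMetric ι} {φ : (ι → ℝ) → (ι → ℝ)}
    {U : Set (ι → ℝ)} (H : g.IsIsometryOn h φ U) {r : ℕ}
    {S T : (ι → ℝ) → (Fin r → (ι → ℝ)) → ℝ} (hT : IsSmoothTensor T)
    (hST : ∀ x ∈ U, ∀ v, T (φ x) (fun a => fderiv ℝ φ x (v a)) = S x v)
    (x : ι → ℝ) (hx : x ∈ U) (v : Fin (r + 1) → (ι → ℝ)) :
    h.nablaTensor T (φ x) (fun a => fderiv ℝ φ x (v a)) = g.nablaTensor S x v := by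
  obtain ⟨M, hM, hTM⟩ := hT
  set w := v (Fin.last r) with hw
  set v' : Fin r → (ι → ℝ) := fun a => v a.castSucc with hv'
  rw [h.nablaTensor_eq hM hTM]
  have hMx : HasFDerivAt M (fderiv ℝ M (φ x)) (φ x) :=
    (hM.differentiable (by simp) _).hasFDerivAt
  have hc : HasFDerivAt (fun y => M (φ y)) (fderiv ℝ M (φ x) ∘L fderiv ℝ φ x) x :=
    HasFDerivAt.comp (g := M) (f := φ) x hMx (H.hasFDerivAt hx)
  have hd := (hc.continuousMultilinearMapCompContinuousLinearMap
    (fun _ : Fin r => H.hasFDerivAt_two hx)).continuousMultilinear_apply_const v'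
  have he : (fun y => S y v') =ᶠ[nhds x]
      fun y => (M (φ y)).compContinuousLinearMap (fun _ => fderiv ℝ φ y) v' := by
    filter_upwards [H.isOpen.mem_nhds hx] with y hy
    rw [← hST y hy, hTM]; rfl
  have hf := (hd.congr_of_eventuallyEq he).fderiv
  rw [nablaTensor]
  simp only [nabla_const, ← hST x hx, hTM]
  rw [hf]
  simp
  rw [add_sub_assoc, ← Finset.sum_sub_distrib, sub_eq_add_neg, ← Finset.sum_neg_distrib]
  refine congrArg₂ _ rfl (Finset.sum_congr rfl fun a _ => ?_)
  have e1 : (fun b => fderiv ℝ φ x (Function.update (fun b => v b.castSucc) a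
      (g.conn x (v (Fin.last r)) (v a.castSucc)) b))
      = Function.update (fun b => fderiv ℝ φ x (v b.castSucc)) a
        (fderiv ℝ φ x (g.conn x (v (Fin.last r)) (v a.castSucc))) := by
    funext b
    exact Function.apply_update (fun _ => fderiv ℝ φ x) _ a _ b
  have e2 : (fun b => (Function.update (fun _ : Fin r => fderiv ℝ φ x) a
      (fderiv ℝ (fderiv ℝ φ) x (v (Fin.last r))) b) (v' b))
      = Function.update (fun b => fderiv ℝ φ x (v b.castSucc)) a
        (fderiv ℝ (fderiv ℝ φ) x (v (Fin.last r)) (v a.castSucc)) := by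
    funext b
    by_cases hb : b = a
    · subst hb; simp [hv']
    · simp [hb, hv']
  rw [e1, e2, H.fderiv_conn_apply hx, ContinuousMultilinearMap.map_update_add]
  ring

theorem IsIsometryOn.nablaR_eq {g h : PseudoMetric ι} {φ : (ι → ℝ) → (ι → ℝ)}
    {U : Set (ι → ℝ)} (H : g.IsIsometryOn h φ U) (i : ℕ) :
    ∀ x ∈ U, ∀ v, h.nablaR i (φ x) (fun a => fderiv ℝ φ x (v a)) = g.nablaR i x v := by
  induction i with
  | zero => exact fun x hx v => H.riemann_eq hx v
  | succ i ih => exact H.nablaTensor_eq (h.isSmoothTensor_nablaR i) ih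

/-- A locally homogeneous metric is curvature homogeneous of every order: the differential of a
local isometry matches the metrics and all covariant derivatives of the curvature. -/
theorem IsLocallyHomogeneous.isCurvatureHomogeneous {g : PseudoMetric ι}
    (hg : g.IsLocallyHomogeneous) (r : ℕ) : g.IsCurvatureHomogeneous r := by
  intro P Q
  obtain ⟨φ, hP, rfl, hφ, -, hi⟩ := hg P Q
  have H : g.IsIsometryOn g φ φ.source :=
    ⟨φ.open_source, hφ, fun x hx v w => by rw [form_apply, form_apply, hi x hx]⟩
  refine ⟨LinearEquiv.ofInjectiveEndo (fderiv ℝ φ P : (ι → ℝ) →ₗ[ℝ] (ι → ℝ))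
    (H.injective_fderiv hP), fun v w => hi P hP v w, fun i _ v => H.nablaR_eq i P hP v⟩

end PseudoMetric

end

/-! ### The connection and the curvature of `g_F` -/

section

variable {k : ℕ} (ε : Fin k → ℤˣ) (f : Fin k → ℝ → ℝ) (hf : ∀ i, ContDiff ℝ ∞ (f i))

/-- The sign `ε_i` as a real number. -/
def sgn (i : Fin k) : ℝ := ((ε i : ℤ) : ℝ)

theorem sgn_mul_self (i : Fin k) : sgn ε i * sgn ε i = 1 := by
  rw [sgn, ← Int.cast_mul, ← Units.val_mul, Int.units_mul_self]; simp

theorem metricF_form (x v w : Coord k → ℝ) :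
    (metricF ε f hf).form x v w
      = ∑ a, (v (cu a) * w (cv a) + v (cv a) * w (cu a))
        + ∑ i, (sgn ε i * v (cs i) * w (cs i)
          + 2 * f i (x (cu i.succ)) * x (cs i)
            * (v (cu 0) * w (cu i.succ) + v (cu i.succ) * w (cu 0))
          - 2 * x (cu 0) * x (cs i) * v (cu i.succ) * w (cu i.succ)) := by
  have huu : ∑ a, ∑ b, gramUU f x a b * v (cu a) * w (cu b)
      = ∑ i, (2 * f i (x (cu i.succ)) * x (cs i)
            * (v (cu 0) * w (cu i.succ) + v (cu i.succ) * w (cu 0))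
          - 2 * x (cu 0) * x (cs i) * v (cu i.succ) * w (cu i.succ)) := by
    simp only [Fin.sum_univ_succ, gramUU, Fin.cases_zero, Fin.cases_succ, ite_mul, zero_mul,
      Finset.sum_ite_eq, Finset.mem_univ, if_true]
    rw [zero_add, ← Finset.sum_add_distrib]
    exact Finset.sum_congr rfl fun i _ => by ring
  rw [PseudoMetric.form_apply, PseudoMetric.inner]
  simp only [metricF, Fintype.sum_sum_type, gramF, ite_mul, one_mul, zero_mul, Finset.sum_ite_eq,
    Finset.mem_univ, if_true, Finset.sum_add_distrib, Finset.sum_const_zero, huu, add_zero,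
    Finset.sum_sub_distrib, sgn]
  ring

/-- The explicit Levi-Civita connection of `g_F` on constant vector fields. -/
def connF (x v w : Coord k → ℝ) : Coord k → ℝ
  | .inl _ => 0
  | .inr (.inl a) => Fin.cases (motive := fun _ => ℝ)
      (∑ i, (f i (x (cu i.succ)) * (v (cu i.succ) * w (cs i) + v (cs i) * w (cu i.succ))
        + (2 * deriv (f i) (x (cu i.succ)) + 1) * x (cs i) * v (cu i.succ) * w (cu i.succ)))
      (fun i => f i (x (cu i.succ)) * (v (cu 0) * w (cs i) + v (cs i) * w (cu 0))
        - x (cs i) * (v (cu 0) * w (cu i.succ) + v (cu i.succ) * w (cu 0))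
        - x (cu 0) * (v (cu i.succ) * w (cs i) + v (cs i) * w (cu i.succ))) a
  | .inr (.inr i) => sgn ε i * (x (cu 0) * v (cu i.succ) * w (cu i.succ)
      - f i (x (cu i.succ)) * (v (cu 0) * w (cu i.succ) + v (cu i.succ) * w (cu 0)))

/-- The derivative of `connF ε f · v w` in the direction `u`. -/
def connFDeriv (x u v w : Coord k → ℝ) : Coord k → ℝ
  | .inl _ => 0
  | .inr (.inl a) => Fin.cases (motive := fun _ => ℝ)
      (∑ i, (deriv (f i) (x (cu i.succ)) * u (cu i.succ)
          * (v (cu i.succ) * w (cs i) + v (cs i) * w (cu i.succ))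
        + (2 * deriv (deriv (f i)) (x (cu i.succ)) * u (cu i.succ) * x (cs i)
          + (2 * deriv (f i) (x (cu i.succ)) + 1) * u (cs i)) * v (cu i.succ) * w (cu i.succ)))
      (fun i => deriv (f i) (x (cu i.succ)) * u (cu i.succ)
          * (v (cu 0) * w (cs i) + v (cs i) * w (cu 0))
        - u (cs i) * (v (cu 0) * w (cu i.succ) + v (cu i.succ) * w (cu 0))
        - u (cu 0) * (v (cu i.succ) * w (cs i) + v (cs i) * w (cu i.succ))) a
  | .inr (.inr i) => sgn ε i * (u (cu 0) * v (cu i.succ) * w (cu i.succ)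
      - deriv (f i) (x (cu i.succ)) * u (cu i.succ)
        * (v (cu 0) * w (cu i.succ) + v (cu i.succ) * w (cu 0)))

theorem hasFDerivAt_coord {ι : Type} [Fintype ι] (c : ι) (x : ι → ℝ) :
    HasFDerivAt (fun y : ι → ℝ => y c)
      (ContinuousLinearMap.proj (R := ℝ) (φ := fun _ : ι => ℝ) c) x :=
  (ContinuousLinearMap.proj (R := ℝ) (φ := fun _ : ι => ℝ) c).hasFDerivAt

theorem hasFDerivAt_comp_coord {ι : Type} [Fintype ι] {F : ℝ → ℝ} (hF : ContDiff ℝ ∞ F) (c : ι)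
    (x : ι → ℝ) : HasFDerivAt (fun y : ι → ℝ => F (y c))
      (deriv F (x c) • ContinuousLinearMap.proj (R := ℝ) (φ := fun _ : ι => ℝ) c) x :=
  ((hF.differentiable (by simp) (x c)).hasDerivAt).comp_hasFDerivAt x (hasFDerivAt_coord c x)

theorem contDiff_deriv {F : ℝ → ℝ} (hF : ContDiff ℝ ∞ F) : ContDiff ℝ ∞ (deriv F) := by
  exact (contDiff_infty_iff_deriv.mp hF).2

theorem metricF_fderiv_form (x u v w : Coord k → ℝ) :
    fderiv ℝ (metricF ε f hf).form x u v w
      = ∑ i, (2 * (deriv (f i) (x (cu i.succ)) * u (cu i.succ) * x (cs i)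
              + f i (x (cu i.succ)) * u (cs i))
            * (v (cu 0) * w (cu i.succ) + v (cu i.succ) * w (cu 0))
          - 2 * (u (cu 0) * x (cs i) + x (cu 0) * u (cs i)) * v (cu i.succ) * w (cu i.succ)) := by
  rw [← PseudoMetric.fderiv_form_apply]
  simp only [← PseudoMetric.form_apply, metricF_form]
  rw [((hasFDerivAt_const _ x).fun_add (HasFDerivAt.fun_sum fun i _ =>
    (((hasFDerivAt_const _ x).fun_add
      ((((hasFDerivAt_comp_coord (hf i) (cu i.succ) x).const_mul 2).fun_mul
        (hasFDerivAt_coord (cs i) x)).mul_const _)).fun_sub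
      (((((hasFDerivAt_coord (cu 0) x).const_mul 2).fun_mul
        (hasFDerivAt_coord (cs i) x)).mul_const _).mul_const _)))).fderiv]
  simp only [add_apply, zero_add, sum_apply, sub_apply, smul_apply,
    ContinuousLinearMap.proj_apply, smul_eq_mul]
  exact Finset.sum_congr rfl fun i _ => by ring

/-- Both sides satisfy the Koszul formula, which determines the connection. -/
theorem metricF_conn (x v w : Coord k → ℝ) :
    (metricF ε f hf).conn x v w = connF ε f x v w := by
  refine (metricF ε f hf).eq_of_form_eq (x := x) fun z => ?_
  have h := (metricF ε f hf).two_mul_form_conn x v w z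
  rw [metricF_fderiv_form, metricF_fderiv_form, metricF_fderiv_form] at h
  refine mul_left_cancel₀ (two_ne_zero' ℝ) (h.trans ?_)
  rw [metricF_form]
  simp only [connF, Fin.sum_univ_succ, Fin.cases_zero, Fin.cases_succ, zero_mul, zero_add, mul_zero,
    add_zero, sub_zero, ← Finset.sum_add_distrib, ← Finset.sum_sub_distrib, Finset.sum_mul,
    Finset.mul_sum]
  refine Finset.sum_congr rfl fun i _ => ?_
  linear_combination (-2 * z (cs i) * (x (cu 0) * v (cu i.succ) * w (cu i.succ)
      - f i (x (cu i.succ)) * (v (cu 0) * w (cu i.succ) + v (cu i.succ) * w (cu 0))))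
      * sgn_mul_self ε i

theorem metricF_fderiv_conn (x u v w : Coord k → ℝ) :
    fderiv ℝ (metricF ε f hf).conn x u v w = connFDeriv ε f x u v w := by
  rw [← PseudoMetric.fderiv_conn_const_apply]
  simp only [metricF_conn]
  have hF : ∀ i, HasFDerivAt (fun y : Coord k → ℝ => f i (y (cu i.succ))) _ x := fun i =>
    hasFDerivAt_comp_coord (hf i) (cu i.succ) x
  have hF' : ∀ i, HasFDerivAt (fun y : Coord k → ℝ => deriv (f i) (y (cu i.succ))) _ x := fun i =>
    hasFDerivAt_comp_coord (contDiff_deriv (hf i)) (cu i.succ) x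
  have hc : ∀ c : Coord k, HasFDerivAt (fun y : Coord k → ℝ => y c) _ x := fun c =>
    hasFDerivAt_coord c x
  have key : ∀ c, ∃ L : (Coord k → ℝ) →L[ℝ] ℝ,
      HasFDerivAt (fun y => connF ε f y v w c) L x ∧ L u = connFDeriv ε f x u v w c := by
    rintro (a | a | i)
    · exact ⟨0, hasFDerivAt_const _ _, rfl⟩
    · refine Fin.cases ?_ (fun i => ?_) a
      · simp only [connF, Fin.cases_zero]
        refine ⟨_, HasFDerivAt.fun_sum fun i _ => ((hF i).mul_const _).fun_add
          ((((((hF' i).const_mul 2).add_const 1).fun_mul (hc (cs i))).mul_const _).mul_const _), ?_⟩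
        simp [connFDeriv]
        exact Finset.sum_congr rfl fun i _ => by ring
      · refine ⟨_, (((hF i).mul_const _).fun_sub ((hc (cs i)).mul_const _)).fun_sub
          ((hc (cu 0)).mul_const _), ?_⟩
        simp [connFDeriv]
        ring
    · refine ⟨_, ((((hc (cu 0)).mul_const _).mul_const _).fun_sub
        ((hF i).mul_const _)).const_mul _, ?_⟩
      simp [connFDeriv]
      left
      ring
  choose L hL hLu using key
  rw [(hasFDerivAt_pi.mpr hL).fderiv]
  funext c
  exact hLu c

/-- The part of the curvature tensor with components `R(∂u_0, ∂u_i, ∂u_i, ∂s_i) = 1`. -/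
def mixedPart (i : Fin k) (v : Fin 4 → Coord k → ℝ) : ℝ :=
  (v 0 (cu 0) * v 1 (cu i.succ) - v 0 (cu i.succ) * v 1 (cu 0))
      * (v 2 (cu i.succ) * v 3 (cs i) - v 2 (cs i) * v 3 (cu i.succ))
    + (v 0 (cu i.succ) * v 1 (cs i) - v 0 (cs i) * v 1 (cu i.succ))
      * (v 2 (cu 0) * v 3 (cu i.succ) - v 2 (cu i.succ) * v 3 (cu 0))

/-- The part of the curvature tensor with components `R(∂u_0, ∂u_i, ∂u_i, ∂u_0) = 1`. -/
def planePart (i : Fin k) (v : Fin 4 → Coord k → ℝ) : ℝ :=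
  -((v 0 (cu 0) * v 1 (cu i.succ) - v 0 (cu i.succ) * v 1 (cu 0))
      * (v 2 (cu 0) * v 3 (cu i.succ) - v 2 (cu i.succ) * v 3 (cu 0)))

theorem metricF_riemann (x : Coord k → ℝ) (v : Fin 4 → Coord k → ℝ) :
    (metricF ε f hf).riemann x v
      = ∑ i, ((deriv (f i) (x (cu i.succ)) + 1) * mixedPart i v
        + sgn ε i * f i (x (cu i.succ)) ^ 2 * planePart i v) := by
  rw [PseudoMetric.riemann_eq, PseudoMetric.curvatureVector, metricF_fderiv_conn,
    metricF_fderiv_conn, metricF_conn, metricF_conn, metricF_conn, metricF_conn, metricF_form]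
  simp only [connF, connFDeriv, Pi.add_apply, Pi.sub_apply, Fin.sum_univ_succ, Fin.cases_zero,
    Fin.cases_succ, zero_mul, zero_add, mul_zero, sub_self,
    add_zero, sub_zero, ← Finset.sum_add_distrib, ← Finset.sum_sub_distrib, Finset.sum_mul,
    mixedPart, planePart]
  refine Finset.sum_congr rfl fun i _ => ?_
  have h := sgn_mul_self ε i
  linear_combination ((v 0 (cu 0) * v 1 (cu i.succ) * v 2 (cu i.succ)
      - deriv (f i) (x (cu i.succ)) * v 0 (cu i.succ)
        * (v 1 (cu 0) * v 2 (cu i.succ) + v 1 (cu i.succ) * v 2 (cu 0))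
      - v 1 (cu 0) * v 0 (cu i.succ) * v 2 (cu i.succ)
      + deriv (f i) (x (cu i.succ)) * v 1 (cu i.succ)
        * (v 0 (cu 0) * v 2 (cu i.succ) + v 0 (cu i.succ) * v 2 (cu 0))) * v 3 (cs i)) * h

end

/-! ### The covariant derivatives of the curvature of `g_F` -/

section

variable {k : ℕ} (ε : Fin k → ℤˣ) (f : Fin k → ℝ → ℝ) (hf : ∀ i, ContDiff ℝ ∞ (f i))

/-- The function `f' + 1`, which is the coefficient of the mixed part of the curvature. -/
def mixedCoeff (F : ℝ → ℝ) (t : ℝ) : ℝ := deriv F t + 1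

/-- The coefficient of the plane part of `∇^m R`, where `e` is the sign of `∂s_i`. -/
def planeCoeff (e : ℝ) (F : ℝ → ℝ) : ℕ → ℝ → ℝ
  | 0 => fun t => e * F t ^ 2
  | m + 1 => fun t => deriv (planeCoeff e F m) t + 2 * e * F t * iteratedDeriv m (mixedCoeff F) t

theorem contDiff_mixedCoeff {F : ℝ → ℝ} (hF : ContDiff ℝ ∞ F) : ContDiff ℝ ∞ (mixedCoeff F) :=
  (contDiff_deriv hF).add contDiff_const

theorem contDiff_iteratedDeriv {F : ℝ → ℝ} (hF : ContDiff ℝ ∞ F) (m : ℕ) :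
    ContDiff ℝ ∞ (iteratedDeriv m F) := by
  induction m with
  | zero => simpa using hF
  | succ m ih => rw [iteratedDeriv_succ]; exact contDiff_deriv ih

theorem contDiff_planeCoeff (e : ℝ) {F : ℝ → ℝ} (hF : ContDiff ℝ ∞ F) (m : ℕ) :
    ContDiff ℝ ∞ (planeCoeff e F m) := by
  induction m with
  | zero => exact contDiff_const.mul (hF.pow 2)
  | succ m ih =>
    exact (contDiff_deriv ih).add
      ((contDiff_const.mul hF).mul (contDiff_iteratedDeriv (contDiff_mixedCoeff hF) m))

/-- The connection acts as a derivation on the mixed part with values in the plane part, which is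
where the second summand of `planeCoeff` comes from. -/
theorem sum_mixedPart_update (x w : Coord k → ℝ) (i : Fin k) (v : Fin 4 → Coord k → ℝ) :
    ∑ a, mixedPart i (Function.update v a (connF ε f x w (v a)))
      = -(2 * sgn ε i * f i (x (cu i.succ)) * w (cu i.succ) * planePart i v) := by
  simp [Fin.sum_univ_four, mixedPart, planePart, connF, Function.update_apply]
  ring

theorem planePart_update (x w : Coord k → ℝ) (i : Fin k) (v : Fin 4 → Coord k → ℝ) (a : Fin 4) :
    planePart i (Function.update v a (connF ε f x w (v a))) = 0 := by
  fin_cases a <;> simp [planePart, connF]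

/-- `∇^m R = ∑ i, (h_i^(m) A_i + q_{i,m} B_i) ⊗ du_i^m`, with `A_i` the mixed part, `B_i` the plane
part, and `q_{i,m}` the plane coefficient. -/
theorem metricF_nablaR (m : ℕ) (x : Coord k → ℝ) (v : Fin (4 + m) → Coord k → ℝ) :
    (metricF ε f hf).nablaR m x v
      = ∑ i, (iteratedDeriv m (mixedCoeff (f i)) (x (cu i.succ))
            * mixedPart i (fun a => v (Fin.castAdd m a))
          + planeCoeff (sgn ε i) (f i) m (x (cu i.succ))
            * planePart i (fun a => v (Fin.castAdd m a)))
        * ∏ j, v (Fin.natAdd 4 j) (cu i.succ) := by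
  induction m generalizing x with
  | zero =>
    simp only [iteratedDeriv_zero, Finset.univ_eq_empty, Finset.prod_empty, mul_one]
    exact metricF_riemann ε f hf x v
  | succ m ih =>
    change (metricF ε f hf).nablaTensor ((metricF ε f hf).nablaR m) x v = _
    set v' : Fin (4 + m) → Coord k → ℝ := fun a => v a.castSucc with hv'
    set w : Coord k → ℝ := v (Fin.last (4 + m)) with hw
    have hA : ∀ i, HasFDerivAt _ _ x := fun i => hasFDerivAt_comp_coord
      (contDiff_iteratedDeriv (contDiff_mixedCoeff (hf i)) m) (cu (Fin.succ i)) x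
    have hB : ∀ i, HasFDerivAt _ _ x := fun i => hasFDerivAt_comp_coord
      (contDiff_planeCoeff (sgn ε i) (hf i) m) (cu (Fin.succ i)) x
    have hd : fderiv ℝ (fun y => (metricF ε f hf).nablaR m y v') x w
        = ∑ i, (iteratedDeriv (m + 1) (mixedCoeff (f i)) (x (cu i.succ))
            * mixedPart i (fun a => v' (Fin.castAdd m a))
          + deriv (planeCoeff (sgn ε i) (f i) m) (x (cu i.succ))
            * planePart i (fun a => v' (Fin.castAdd m a)))
        * (∏ j, v' (Fin.natAdd 4 j) (cu i.succ)) * w (cu i.succ) := by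
      simp only [ih]
      rw [(HasFDerivAt.fun_sum fun i _ =>
        (((hA i).mul_const _).fun_add ((hB i).mul_const _)).mul_const _).fderiv]
      simp only [sum_apply, smul_apply, add_apply, ContinuousLinearMap.proj_apply, smul_eq_mul,
        iteratedDeriv_succ]
      exact Finset.sum_congr rfl fun i _ => by ring
    have hs : ∑ a, (metricF ε f hf).nablaR m x
          (Function.update v' a (connF ε f x w (v' a)))
        = ∑ i, -(2 * sgn ε i * f i (x (cu i.succ)) * w (cu i.succ)
            * planePart i (fun a => v' (Fin.castAdd m a)))
          * iteratedDeriv m (mixedCoeff (f i)) (x (cu i.succ))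
          * ∏ j, v' (Fin.natAdd 4 j) (cu i.succ) := by
      have h1 : ∀ b : Fin 4, (metricF ε f hf).nablaR m x
          (Function.update v' (Fin.castAdd m b) (connF ε f x w (v' (Fin.castAdd m b))))
          = ∑ i, iteratedDeriv m (mixedCoeff (f i)) (x (cu i.succ))
            * mixedPart i (Function.update (fun a => v' (Fin.castAdd m a)) b
                (connF ε f x w (v' (Fin.castAdd m b))))
            * ∏ j, v' (Fin.natAdd 4 j) (cu i.succ) := by
        intro b
        rw [ih]
        refine Finset.sum_congr rfl fun i _ => ?_
        have e1 : (fun a => Function.update v' (Fin.castAdd m b)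
            (connF ε f x w (v' (Fin.castAdd m b))) (Fin.castAdd m a))
            = Function.update (fun a => v' (Fin.castAdd m a)) b
                (connF ε f x w (v' (Fin.castAdd m b))) :=
          Function.update_comp_eq_of_injective v' (Fin.castAdd_injective 4 m) b _
        have e2 : ∀ j : Fin m, Function.update v' (Fin.castAdd m b)
            (connF ε f x w (v' (Fin.castAdd m b))) (Fin.natAdd 4 j) = v' (Fin.natAdd 4 j) :=
          fun j => Function.update_of_ne (by simp [Fin.ext_iff]; omega) _ _
        simp only [e1, e2]
        rw [planePart_update ε f x w i (fun a => v' (Fin.castAdd m a)) b]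
        ring
      have h2 : ∀ j : Fin m, (metricF ε f hf).nablaR m x
          (Function.update v' (Fin.natAdd 4 j) (connF ε f x w (v' (Fin.natAdd 4 j)))) = 0 := by
        intro j
        rw [ih]
        refine Finset.sum_eq_zero fun i _ => ?_
        rw [Finset.prod_eq_zero (Finset.mem_univ j), mul_zero]
        simp [connF]
      rw [Fin.sum_univ_add]
      simp only [h1, h2, Finset.sum_const_zero, add_zero]
      rw [Finset.sum_comm]
      refine Finset.sum_congr rfl fun i _ => ?_
      rw [← sum_mixedPart_update, Finset.sum_mul, Finset.sum_mul]
      exact Finset.sum_congr rfl fun b _ => by ring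
    rw [PseudoMetric.nablaTensor]
    simp only [PseudoMetric.nabla_const, metricF_conn]
    change fderiv ℝ (fun y => (metricF ε f hf).nablaR m y v') x w -
      ∑ a, (metricF ε f hf).nablaR m x (Function.update v' a (connF ε f x w (v' a))) = _
    rw [hd, hs, ← Finset.sum_sub_distrib]
    refine Finset.sum_congr rfl fun i _ => ?_
    rw [Fin.prod_univ_castSucc]
    change _ = (_ * mixedPart i (fun a => v' (Fin.castAdd m a))
      + _ * planePart i (fun a => v' (Fin.castAdd m a)))
      * ((∏ j, v' (Fin.natAdd 4 j) (cu i.succ)) * w (cu i.succ))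
    simp only [planeCoeff]
    ring

end

/-! ### Isomorphisms of `2`-curvature models and their invariants -/

section

variable {k : ℕ} (ε : Fin k → ℤˣ) (f : Fin k → ℝ → ℝ) (hf : ∀ i, ContDiff ℝ ∞ (f i))

/-- The value of `∇^m R` at `x` on the four vectors `q`, differentiated `m` times in the
direction `y`. -/
def curvPow (m : ℕ) (x : Coord k → ℝ) (q : Fin 4 → Coord k → ℝ) (y : Coord k → ℝ) : ℝ :=
  ∑ i, (iteratedDeriv m (mixedCoeff (f i)) (x (cu i.succ)) * mixedPart i q
    + planeCoeff (sgn ε i) (f i) m (x (cu i.succ)) * planePart i q) * y (cu i.succ) ^ m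

theorem metricF_nablaR_append (m : ℕ) (x : Coord k → ℝ) (q : Fin 4 → Coord k → ℝ)
    (y : Coord k → ℝ) :
    (metricF ε f hf).nablaR m x (Fin.append q fun _ => y) = curvPow ε f m x q y := by
  simp [metricF_nablaR, curvPow]

/-- A linear isomorphism `T_P → T_Q` that preserves the metric `g_F` and the values of `R`, `∇R` and
`∇²R`, where only equal directions of differentiation are considered. -/
structure IsModelIso (P Q : Coord k → ℝ) (Φ : (Coord k → ℝ) ≃ₗ[ℝ] (Coord k → ℝ)) : Prop where
  form_eq : ∀ v w, (metricF ε f hf).form Q (Φ v) (Φ w) = (metricF ε f hf).form P v w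
  curv_eq : ∀ m ≤ 2, ∀ q y, curvPow ε f m Q (fun a => Φ (q a)) (Φ y) = curvPow ε f m P q y

theorem exists_isModelIso (h : (metricF ε f hf).IsCurvatureHomogeneous 2) (P Q : Coord k → ℝ) :
    ∃ Φ, IsModelIso ε f hf P Q Φ := by
  obtain ⟨Φ, h1, h2⟩ := h P Q
  refine ⟨Φ, fun v w => ?_, fun m hm q y => ?_⟩
  · rw [PseudoMetric.form_apply, PseudoMetric.form_apply, h1]
  · rw [← metricF_nablaR_append ε f hf, ← metricF_nablaR_append ε f hf, ← h2 m hm]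
    congr 1
    funext a
    refine Fin.addCases (fun a => ?_) (fun a => ?_) a <;> simp

/-- On these arguments only the components `R(∂u_0, ∂u_i, ∂u_i, ∂s_i)` contribute. -/
theorem curvPow_mixed (m : ℕ) {x z X Y s y : Coord k → ℝ} (hz : ∀ i : Fin k, z (cu i.succ) = 0)
    (hs : ∀ a, s (cu a) = 0) :
    curvPow ε f m x ![z, X, Y, s] y = z (cu 0) *
      ∑ i, iteratedDeriv m (mixedCoeff (f i)) (x (cu i.succ)) *
        (X (cu i.succ) * Y (cu i.succ) * s (cs i) * y (cu i.succ) ^ m) := by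
  rw [curvPow, Finset.mul_sum]
  refine Finset.sum_congr rfl fun i _ => ?_
  simp [mixedPart, planePart, hz, hs]
  ring

theorem curvPow_plane (m : ℕ) {x z X Y y : Coord k → ℝ} (hz : ∀ i : Fin k, z (cu i.succ) = 0) :
    curvPow ε f m x ![z, X, Y, z] y = z (cu 0) *
      ∑ i, (2 * iteratedDeriv m (mixedCoeff (f i)) (x (cu i.succ)) * z (cs i)
        + planeCoeff (sgn ε i) (f i) m (x (cu i.succ)) * z (cu 0)) *
        (X (cu i.succ) * Y (cu i.succ) * y (cu i.succ) ^ m) := by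
  rw [curvPow, Finset.mul_sum]
  refine Finset.sum_congr rfl fun i _ => ?_
  simp [mixedPart, planePart, hz]
  ring

namespace IsModelIso

variable {ε f hf} {P Q : Coord k → ℝ} {Φ : (Coord k → ℝ) ≃ₗ[ℝ] (Coord k → ℝ)}

theorem symm (H : IsModelIso ε f hf P Q Φ) : IsModelIso ε f hf Q P Φ.symm where
  form_eq v w := by rw [← H.form_eq]; simp
  curv_eq m hm q y := by rw [← H.curv_eq m hm]; simp

theorem curv_eq' (H : IsModelIso ε f hf P Q Φ) {m : ℕ} (hm : m ≤ 2) (a b c d y : Coord k → ℝ) :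
    curvPow ε f m Q ![Φ a, Φ b, Φ c, Φ d] (Φ y) = curvPow ε f m P ![a, b, c, d] y := by
  rw [← H.curv_eq m hm]
  congr 1
  funext j
  fin_cases j <;> rfl

/-- The kernel of `R`, spanned by the `∂v_a`, is preserved. -/
theorem map_kernel (H : IsModelIso ε f hf P Q Φ) (hf1 : ∀ i t, mixedCoeff (f i) t ≠ 0)
    (i₀ : Fin k) {n : Coord k → ℝ} (hu : ∀ a, n (cu a) = 0) (hs : ∀ i, n (cs i) = 0) :
    (∀ a, Φ n (cu a) = 0) ∧ ∀ i, Φ n (cs i) = 0 := by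
  have h0 : ∀ b c d, curvPow ε f 0 Q ![Φ n, b, c, d] 0 = 0 := by
    intro b c d
    have := H.curv_eq' (m := 0) (by simp) n (Φ.symm b) (Φ.symm c) (Φ.symm d) 0
    simp only [LinearEquiv.apply_symm_apply, map_zero] at this
    rw [this]
    simp [curvPow, mixedPart, planePart, hu, hs]
  have e0 : ∀ _ : Fin k, Φ n (cu 0) = 0 := fun i => by
    have := h0 (Pi.single (cu i.succ) 1) (Pi.single (cu i.succ) 1) (Pi.single (cs i) 1)
    simpa [curvPow, mixedPart, planePart, Pi.single_apply, hf1] using this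
  have e1 : ∀ i : Fin k, Φ n (cu i.succ) = 0 := fun i => by
    have := h0 (Pi.single (cu 0) 1) (Pi.single (cu i.succ) 1) (Pi.single (cs i) 1)
    simpa [curvPow, mixedPart, planePart, Pi.single_apply, hf1] using this
  refine ⟨Fin.cases (e0 i₀) e1, fun i => ?_⟩
  have := h0 (Pi.single (cu i.succ) 1) (Pi.single (cu 0) 1) (Pi.single (cu i.succ) 1)
  simpa [curvPow, mixedPart, planePart, Pi.single_apply, hf1, e0 i₀, e1] using this

/-- The orthogonal complement of the kernel of `R`, spanned by the `∂v_a` and `∂s_i`, is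
preserved. -/
theorem map_orthogonal (H : IsModelIso ε f hf P Q Φ) (hf1 : ∀ i t, mixedCoeff (f i) t ≠ 0)
    (i₀ : Fin k) {s : Coord k → ℝ} (hs : ∀ a, s (cu a) = 0) (a : Fin (k + 1)) :
    Φ s (cu a) = 0 := by
  obtain ⟨h1, h2⟩ := H.symm.map_kernel hf1 i₀ (n := Pi.single (cv a) 1) (by simp) (by simp)
  have h := H.form_eq s (Φ.symm (Pi.single (cv a) 1))
  rw [LinearEquiv.apply_symm_apply, metricF_form, metricF_form] at h
  simpa [hs, h1, h2, Pi.single_apply] using h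

/-- The kernel of `∇R` in the direction of differentiation, on which `du_1, …, du_k` vanish, is
preserved. -/
theorem map_flat (H : IsModelIso ε f hf P Q Φ)
    (hf2 : ∀ i t, deriv (mixedCoeff (f i)) t ≠ 0)
    {w : Coord k → ℝ} (hw : ∀ i : Fin k, w (cu i.succ) = 0) (i : Fin k) :
    Φ w (cu i.succ) = 0 := by
  have h := H.curv_eq' (m := 1) (by simp) (Φ.symm (Pi.single (cu 0) 1))
    (Φ.symm (Pi.single (cu i.succ) 1)) (Φ.symm (Pi.single (cu i.succ) 1))
    (Φ.symm (Pi.single (cs i) 1)) w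
  simp only [LinearEquiv.apply_symm_apply] at h
  have h0 : curvPow ε f 1 P ![Φ.symm (Pi.single (cu 0) 1), Φ.symm (Pi.single (cu i.succ) 1),
      Φ.symm (Pi.single (cu i.succ) 1), Φ.symm (Pi.single (cs i) 1)] w = 0 := by
    simp [curvPow, hw]
  rw [h0, curvPow_mixed _ _ _ (by simp) (by simp)] at h
  have := hf2 i (Q (cu i.succ))
  simpa [Pi.single_apply, this] using h

/-- The relations between the coefficients of the curvature at `P` and `Q` that a model isomorphism
`Φ` imposes. For each `a` there is `j` such that they hold with `c = du_0(Φ∂u_0)`,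
`l = du_j(Φ∂u_a)`, `y = du_a(Φ⁻¹∂u_j)`, `σ = ds_j(Φ∂u_0)` and `W = ds_a(Φ⁻¹∂s_j)`. -/
theorem exists_relations (H : IsModelIso ε f hf P Q Φ) (hf1 : ∀ i t, mixedCoeff (f i) t ≠ 0)
    (hf2 : ∀ i t, deriv (mixedCoeff (f i)) t ≠ 0) (a : Fin k) :
    ∃ j : Fin k, ∃ c l y σ W : ℝ, c ≠ 0 ∧ l ≠ 0 ∧ y * l = 1 ∧ W ^ 2 = 1 ∧
      (∀ m ≤ 2, c * l * iteratedDeriv m (mixedCoeff (f j)) (Q (cu j.succ))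
        = y ^ (m + 1) * W * iteratedDeriv m (mixedCoeff (f a)) (P (cu a.succ))) ∧
      (∀ m ≤ 2, c * l * (2 * σ * iteratedDeriv m (mixedCoeff (f j)) (Q (cu j.succ))
          + c * planeCoeff (sgn ε j) (f j) m (Q (cu j.succ)))
        = y ^ (m + 1) * planeCoeff (sgn ε a) (f a) m (P (cu a.succ))) := by
  set z := Φ (Pi.single (cu 0) 1) with hzdef
  have hz0 : ∀ i : Fin k, (Pi.single (cu 0) 1 : Coord k → ℝ) (cu i.succ) = 0 := by simp
  have hz : ∀ i : Fin k, z (cu i.succ) = 0 := H.map_flat hf2 hz0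
  -- Some `du_j` is nonzero on the image of `∂u_a`, as `Φ⁻¹` preserves their common kernel.
  obtain ⟨j, hj⟩ : ∃ j : Fin k, Φ (Pi.single (cu a.succ) 1) (cu j.succ) ≠ 0 := by
    by_contra! hcon
    have := H.symm.map_flat hf2 hcon a
    simp at this
  have hc : z (cu 0) ≠ 0 := by
    intro h0
    have h1 : ∀ b, z (cu b) = 0 := Fin.cases h0 hz
    have := H.symm.map_orthogonal hf1 a h1 0
    simp [hzdef] at this
  set X := Φ (Pi.single (cu a.succ) 1) with hX
  set s := Φ.symm (Pi.single (cs j) 1) with hs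
  have hs0 : ∀ b, (Pi.single (cs j) 1 : Coord k → ℝ) (cu b) = 0 := by simp
  have hsu : ∀ b, s (cu b) = 0 := H.symm.map_orthogonal hf1 a hs0
  set y := Φ.symm (Pi.single (cu j.succ) 1) with hy
  have hΦs : Φ s = Pi.single (cs j) 1 := by simp [hs]
  have hΦy : Φ y = Pi.single (cu j.succ) 1 := by simp [hy]
  -- `R(Φ∂u_0, Φ∂u_a, Φ∂u_b, ∂s_j)`
  have r1 : ∀ b : Fin k, z (cu 0) * (mixedCoeff (f j) (Q (cu j.succ)) * (X (cu j.succ)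
      * Φ (Pi.single (cu b.succ) 1) (cu j.succ)))
      = if b = a then mixedCoeff (f b) (P (cu b.succ)) * s (cs b) else 0 := by
    intro b
    have h := H.curv_eq' (m := 0) (by simp) (Pi.single (cu 0) 1) (Pi.single (cu a.succ) 1)
      (Pi.single (cu b.succ) 1) s 0
    rw [← hzdef, ← hX, hΦs, curvPow_mixed _ _ _ hz hs0, curvPow_mixed _ _ _ hz0 hsu] at h
    simpa [Pi.single_apply] using h
  have r2 : ∀ b : Fin k, z (cu 0) * (mixedCoeff (f j) (Q (cu j.succ)) *
      Φ (Pi.single (cu b.succ) 1) (cu j.succ) ^ 2)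
      = mixedCoeff (f b) (P (cu b.succ)) * s (cs b) := by
    intro b
    have h := H.curv_eq' (m := 0) (by simp) (Pi.single (cu 0) 1) (Pi.single (cu b.succ) 1)
      (Pi.single (cu b.succ) 1) s 0
    rw [← hzdef, hΦs, curvPow_mixed _ _ _ hz hs0, curvPow_mixed _ _ _ hz0 hsu] at h
    simpa [Pi.single_apply, sq] using h
  have hsb : ∀ b, b ≠ a → s (cs b) = 0 := by
    intro b hb
    have h1 := r1 b
    rw [if_neg hb] at h1
    have h2 : Φ (Pi.single (cu b.succ) 1) (cu j.succ) = 0 := by simpa [hc, hf1, hj] using h1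
    have h3 := r2 b
    rw [h2] at h3
    simpa [hf1] using h3.symm
  -- Modulo the kernel of `R`, the vector `Φ⁻¹∂s_j` is a multiple of `∂s_a`; it has length `±1`.
  have hW : s (cs a) ^ 2 = 1 := by
    have h := H.form_eq s s
    rw [hΦs, metricF_form, metricF_form] at h
    have hQ : ∑ i, sgn ε i * (Pi.single (cs j) 1 : Coord k → ℝ) (cs i)
        * (Pi.single (cs j) 1 : Coord k → ℝ) (cs i) = sgn ε j := by
      simp [Pi.single_apply]
    have hP : ∑ i, sgn ε i * s (cs i) * s (cs i) = sgn ε a * s (cs a) * s (cs a) :=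
      Finset.sum_eq_single a (fun b _ hb => by simp [hsb b hb]) (by simp)
    simp only [hsu, hs0, zero_mul, mul_zero, add_zero, sub_zero, Finset.sum_const_zero, zero_add,
      hQ, hP] at h
    have h1 : s (cs a) ^ 2 = sgn ε a * sgn ε j := by
      linear_combination -(s (cs a) ^ 2) * sgn_mul_self ε a - sgn ε a * h
    have h2 : (s (cs a) ^ 2) ^ 2 = 1 := by
      rw [h1]
      linear_combination sgn ε j ^ 2 * sgn_mul_self ε a + sgn_mul_self ε j
    exact (pow_eq_one_iff_of_nonneg (sq_nonneg _) two_ne_zero).mp h2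
  have hmix : ∀ m ≤ 2, z (cu 0) * X (cu j.succ) * iteratedDeriv m (mixedCoeff (f j)) (Q (cu j.succ))
        = y (cu a.succ) ^ (m + 1) * s (cs a)
          * iteratedDeriv m (mixedCoeff (f a)) (P (cu a.succ)) := by
    intro m hm
    have h := H.curv_eq' hm (Pi.single (cu 0) 1) (Pi.single (cu a.succ) 1) y s y
    rw [← hzdef, ← hX, hΦs, hΦy, curvPow_mixed _ _ _ hz hs0, curvPow_mixed _ _ _ hz0 hsu,
      Finset.sum_eq_single j (fun b _ hb => by simp [hb]) (by simp),
      Finset.sum_eq_single a (fun b _ hb => by simp [hb]) (by simp)] at h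
    simp only [Pi.single_eq_same, one_pow, mul_one, one_mul] at h
    linear_combination h
  refine ⟨j, z (cu 0), X (cu j.succ), y (cu a.succ), z (cs j), s (cs a), hc, hj, ?_, hW, hmix, ?_⟩
  · have h1 := hmix 0 (by simp)
    have h2 := r2 a
    simp only [iteratedDeriv_zero] at h1
    rw [← hX] at h2
    have hne : z (cu 0) * X (cu j.succ) * mixedCoeff (f j) (Q (cu j.succ)) ≠ 0 :=
      mul_ne_zero (mul_ne_zero hc hj) (hf1 _ _)
    refine mul_left_cancel₀ hne ?_
    linear_combination y (cu a.succ) * h2 - h1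
  · intro m hm
    have h := H.curv_eq' hm (Pi.single (cu 0) 1) (Pi.single (cu a.succ) 1) y
      (Pi.single (cu 0) 1) y
    rw [← hzdef, ← hX, hΦy, curvPow_plane _ _ _ hz, curvPow_plane _ _ _ hz0,
      Finset.sum_eq_single j (fun b _ hb => by simp [hb]) (by simp),
      Finset.sum_eq_single a (fun b _ hb => by simp [hb]) (by simp)] at h
    simp only [Pi.single_eq_same, one_pow, mul_one, one_mul] at h
    simp only [ne_eq, reduceCtorEq, not_false_eq_true, Pi.single_eq_of_ne, mul_zero, zero_add] at h
    linear_combination h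

end IsModelIso

/-- The invariant `h h'' / h'²` of the function `h = f' + 1`. -/
def mixedInvariant (F : ℝ → ℝ) (t : ℝ) : ℝ :=
  mixedCoeff F t * iteratedDeriv 2 (mixedCoeff F) t / deriv (mixedCoeff F) t ^ 2

/-- The invariant `h' (h q₁ - h' q₀) / h⁴`, where `h` and `h'` are the coefficients of the mixed
parts of `R` and `∇R`, and `q₀` and `q₁` are those of their plane parts. -/
def planeInvariant (e : ℝ) (F : ℝ → ℝ) (t : ℝ) : ℝ :=
  deriv (mixedCoeff F) t * (mixedCoeff F t * planeCoeff e F 1 t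
    - deriv (mixedCoeff F) t * planeCoeff e F 0 t) / mixedCoeff F t ^ 4

/-- A model isomorphism matches the invariants of each index at `P` with those of some index at
`Q`; the unknown scaling factors cancel in both invariants. -/
theorem IsModelIso.exists_invariant_eq {ε f hf} {P Q : Coord k → ℝ}
    {Φ : (Coord k → ℝ) ≃ₗ[ℝ] (Coord k → ℝ)} (H : IsModelIso ε f hf P Q Φ)
    (hf1 : ∀ i t, mixedCoeff (f i) t ≠ 0) (hf2 : ∀ i t, deriv (mixedCoeff (f i)) t ≠ 0)
    (a : Fin k) :
    ∃ j, mixedInvariant (f a) (P (cu a.succ)) = mixedInvariant (f j) (Q (cu j.succ)) ∧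
      planeInvariant (sgn ε a) (f a) (P (cu a.succ))
        = planeInvariant (sgn ε j) (f j) (Q (cu j.succ)) := by
  obtain ⟨j, c, l, y, σ, W, hc, hl, hyl, hW, hA, hB⟩ := H.exists_relations hf1 hf2 a
  refine ⟨j, ?_⟩
  have hA0 := hA 0 (by simp)
  have hA1 := hA 1 (by simp)
  have hA2 := hA 2 (by simp)
  have hB0 := hB 0 (by simp)
  have hB1 := hB 1 (by simp)
  have n1 := hf1 a (P (cu a.succ))
  have n2 := hf2 a (P (cu a.succ))
  have n3 := hf1 j (Q (cu j.succ))
  have n4 := hf2 j (Q (cu j.succ))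
  simp only [iteratedDeriv_zero, iteratedDeriv_one] at hA0 hA1 hA2 hB0 hB1
  unfold mixedInvariant planeInvariant
  generalize mixedCoeff (f a) (P (cu a.succ)) = h at *
  generalize mixedCoeff (f j) (Q (cu j.succ)) = H at *
  generalize deriv (mixedCoeff (f a)) (P (cu a.succ)) = h' at *
  generalize deriv (mixedCoeff (f j)) (Q (cu j.succ)) = H' at *
  generalize iteratedDeriv 2 (mixedCoeff (f a)) (P (cu a.succ)) = h'' at *
  generalize iteratedDeriv 2 (mixedCoeff (f j)) (Q (cu j.succ)) = H'' at *
  generalize planeCoeff (sgn ε a) (f a) 0 (P (cu a.succ)) = p at *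
  generalize planeCoeff (sgn ε a) (f a) 1 (P (cu a.succ)) = q at *
  generalize planeCoeff (sgn ε j) (f j) 0 (Q (cu j.succ)) = p' at *
  generalize planeCoeff (sgn ε j) (f j) 1 (Q (cu j.succ)) = q' at *
  have hy : y ≠ 0 := left_ne_zero_of_mul_eq_one hyl
  have hW0 : W ≠ 0 := by rintro rfl; simp at hW
  have hWi : W * W = 1 := by rw [← sq]; exact hW
  -- Solve for the invariants at `P`, using `l = y⁻¹` and `W = W⁻¹`.
  have hyn : ∀ n : ℕ, y ^ n * l ^ n = 1 := fun n => by rw [← mul_pow, hyl, one_pow]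
  have e0 : h = c * l ^ 2 * W * H := by
    linear_combination -h * hyn 1 - l * W * hA0 - h * y * l * hWi
  have e1 : h' = c * l ^ 3 * W * H' := by
    linear_combination -h' * hyn 2 - l ^ 2 * W * hA1 - h' * y ^ 2 * l ^ 2 * hWi
  have e2 : h'' = c * l ^ 4 * W * H'' := by
    linear_combination -h'' * hyn 3 - l ^ 3 * W * hA2 - h'' * y ^ 3 * l ^ 3 * hWi
  have e3 : p = c * l ^ 2 * (2 * σ * H + c * p') := by
    linear_combination -p * hyn 1 - l * hB0
  have e4 : q = c * l ^ 3 * (2 * σ * H' + c * q') := by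
    linear_combination -q * hyn 2 - l ^ 2 * hB1
  constructor
  · rw [e0, e1, e2]
    field_simp
  · rw [e0, e1, e3, e4]
    field_simp
    rw [hW]
    ring

end

/-! ### Functions with constant invariants -/

section

open Filter in
/-- If both invariants of `F` were constant on the whole line, then `h = F' + 1` would be an
exponential function `a e^{bt}`, so that `b F = h - b t + const`, and the second invariant would
be unbounded. -/
theorem not_const_invariants {F : ℝ → ℝ} (hF : ContDiff ℝ ∞ F) (h1 : ∀ t, mixedCoeff F t ≠ 0)
    (h2 : ∀ t, deriv (mixedCoeff F) t ≠ 0) {e : ℝ} (he : e * e = 1) {κ C : ℝ}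
    (hκ : ∀ t, mixedInvariant F t = κ) (hC : ∀ t, planeInvariant e F t = C) : False := by
  set h := mixedCoeff F with hh
  have hs : ContDiff ℝ ∞ h := contDiff_mixedCoeff hF
  have dh : ∀ t, HasDerivAt h (deriv h t) t := fun t =>
    (hs.differentiable (by simp) t).hasDerivAt
  have dh' : ∀ t, HasDerivAt (deriv h) (iteratedDeriv 2 h t) t := fun t => by
    rw [iteratedDeriv_succ, iteratedDeriv_one]
    exact ((contDiff_deriv hs).differentiable (by simp) t).hasDerivAt
  have dF : ∀ t, HasDerivAt F (h t - 1) t := fun t => by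
    refine (hF.differentiable (by simp) t).hasDerivAt.congr_deriv ?_
    rw [hh, mixedCoeff, add_sub_cancel_right]
  have const : ∀ {G : ℝ → ℝ}, (∀ t, HasDerivAt G 0 t) → ∀ t, G t = G 0 := fun hG t =>
    is_const_of_deriv_eq_zero (fun s => (hG s).differentiableAt) (fun s => (hG s).deriv) t 0
  -- `h / h'` is affine of slope `1 - κ` and has no zero, so it is constant.
  have hq : ∀ t, h t / deriv h t = (1 - κ) * t + h 0 / deriv h 0 := by
    intro t
    have := const (G := fun t => h t / deriv h t - (1 - κ) * t) (fun t => by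
      refine (((dh t).fun_div (dh' t) (h2 t)).fun_sub
        ((hasDerivAt_id t).const_mul (1 - κ))).congr_deriv ?_
      have := hκ t
      rw [mixedInvariant, ← hh] at this
      rw [← this]
      have := h2 t
      field_simp
      ring) t
    simp only [mul_zero, sub_zero] at this
    linarith
  have hκ1 : 1 - κ = 0 := by
    by_contra hne
    have := hq (-(h 0 / deriv h 0) / (1 - κ))
    rw [mul_div_cancel₀ _ hne, neg_add_cancel] at this
    exact div_ne_zero (h1 _) (h2 _) this
  obtain ⟨b, hb0, hb⟩ : ∃ b : ℝ, b ≠ 0 ∧ ∀ t, deriv h t = b * h t := by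
    refine ⟨deriv h 0 / h 0, div_ne_zero (h2 0) (h1 0), fun t => ?_⟩
    have := hq t
    rw [hκ1, zero_mul, zero_add] at this
    have := h1 0; have := h2 0; have := h1 t; have := h2 t
    field_simp at *
    linarith
  have hexp : ∀ t, h t = h 0 * Real.exp (b * t) := by
    intro t
    have := const (G := fun t => h t * Real.exp (-(b * t))) (fun t => by
      refine ((dh t).fun_mul (((hasDerivAt_id t).const_mul b).fun_neg.exp)).congr_deriv ?_
      rw [hb t]; simp; ring) t
    simp only [mul_zero, neg_zero, Real.exp_zero, mul_one] at this
    rw [← this, mul_assoc, ← Real.exp_add]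
    simp
  obtain ⟨c, hbF⟩ : ∃ c : ℝ, ∀ t, b * F t = h t - b * t + c := by
    refine ⟨b * F 0 - h 0, fun t => ?_⟩
    have := const (G := fun t => b * F t - h t + b * t) (fun t => by
      refine ((((dF t).const_mul b).fun_sub (dh t)).fun_add
        ((hasDerivAt_id t).const_mul b)).congr_deriv ?_
      rw [hb t]; ring) t
    simp only [mul_zero, add_zero] at this
    linarith
  have hC' : ∀ t, (b * F t) * (4 * h t - 2 - b * F t) = e * C * h t ^ 2 := by
    intro t
    have hp : planeCoeff e F 1 t = 2 * e * F t * (2 * h t - 1) := by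
      have : deriv (planeCoeff e F 0) t = e * (2 * F t * (h t - 1)) := by
        have := (((dF t).fun_pow 2).const_mul e).deriv
        simpa [planeCoeff] using this
      change deriv (planeCoeff e F 0) t + 2 * e * F t * h t = _
      rw [this]
      ring
    have := hC t
    rw [planeInvariant, ← hh, hp, hb t, div_eq_iff (pow_ne_zero 4 (h1 t))] at this
    change b * h t * (h t * (2 * e * F t * (2 * h t - 1)) - b * h t * (e * F t ^ 2)) = _ at this
    refine mul_left_cancel₀ (pow_ne_zero 2 (h1 t)) ?_
    linear_combination e * this - h t ^ 2 * (b * F t) * (4 * h t - 2 - b * F t) * he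
  -- Along `t = -τ / b`, `τ → ∞`, the function `h` tends to `0` and `b F` to `∞`.
  have lh : Tendsto (fun τ => h (-τ / b)) atTop (nhds 0) := by
    have : (fun τ => h (-τ / b)) = fun τ => h 0 * Real.exp (-τ) := by
      funext τ
      rw [hexp, mul_div_cancel₀ _ hb0]
    rw [this]
    simpa using (Real.tendsto_exp_neg_atTop_nhds_zero).const_mul (h 0)
  have lF : Tendsto (fun τ => b * F (-τ / b)) atTop atTop := by
    have : (fun τ => b * F (-τ / b)) = fun τ => (h (-τ / b) + c) + τ := by
      funext τ
      rw [hbF, mul_div_cancel₀ _ hb0]; ring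
    rw [this]
    exact (lh.add_const c).add_atTop tendsto_id
  have lG : Tendsto (fun τ => 4 * h (-τ / b) - 2 - b * F (-τ / b)) atTop atBot := by
    simp only [sub_eq_add_neg _ (b * F _)]
    exact ((lh.const_mul 4).sub_const 2).add_atBot (tendsto_neg_atTop_atBot.comp lF)
  have l1 := lF.atTop_mul_atBot₀ lG
  have l2 := (lh.pow 2).const_mul (e * C)
  simp only [hC'] at l1
  exact not_tendsto_nhds_of_tendsto_atBot l1 _ l2

theorem eq_of_mem_finite {G : ℝ → ℝ} (hG : Continuous G) {S : Set ℝ} (hS : S.Finite)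
    (h : ∀ t, G t ∈ S) (t : ℝ) : G t = G 0 := by
  have hsub : (Set.range G).Subsingleton :=
    ((hS.subset (Set.range_subset_iff.mpr h)).countable.isTotallyDisconnected) _ subset_rfl
      (isPreconnected_range hG)
  exact hsub ⟨t, rfl⟩ ⟨0, rfl⟩

theorem not_isCurvatureHomogeneous_two {k : ℕ} (hk : 1 ≤ k) (ε : Fin k → ℤˣ) (f : Fin k → ℝ → ℝ)
    (hf : ∀ i, ContDiff ℝ ∞ (f i)) (hf1 : ∀ i t, mixedCoeff (f i) t ≠ 0)
    (hf2 : ∀ i t, deriv (mixedCoeff (f i)) t ≠ 0) :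
    ¬ (metricF ε f hf).IsCurvatureHomogeneous 2 := by
  intro hom
  set a : Fin k := ⟨0, hk⟩
  have hinv : ∀ t : ℝ, ∃ j, mixedInvariant (f a) t = mixedInvariant (f j) 0 ∧
      planeInvariant (sgn ε a) (f a) t = planeInvariant (sgn ε j) (f j) 0 := by
    intro t
    obtain ⟨Φ, H⟩ := exists_isModelIso ε f hf hom (fun _ => t) 0
    exact H.exists_invariant_eq hf1 hf2 a
  have hs := contDiff_mixedCoeff (hf a)
  have c0 := hs.continuous
  have c1 := (contDiff_deriv hs).continuous
  have c2 := (contDiff_iteratedDeriv hs 2).continuous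
  have p0 := (contDiff_planeCoeff (sgn ε a) (hf a) 0).continuous
  have p1 := (contDiff_planeCoeff (sgn ε a) (hf a) 1).continuous
  -- The invariants at the origin form a finite set, so by continuity they are constant in `t`.
  refine not_const_invariants (hf a) (hf1 a) (hf2 a) (sgn_mul_self ε a)
    (eq_of_mem_finite ?_ (Set.finite_range fun j => mixedInvariant (f j) 0) fun t => ?_)
    (eq_of_mem_finite ?_ (Set.finite_range fun j => planeInvariant (sgn ε j) (f j) 0) fun t => ?_)
  · exact (c0.mul c2).div (c1.pow 2) fun t => pow_ne_zero 2 (hf2 a t)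
  · obtain ⟨j, hj, -⟩ := hinv t
    exact ⟨j, hj.symm⟩
  · exact (c1.mul ((c0.mul p1).sub (c1.mul p0))).div (c0.pow 4) fun t => pow_ne_zero 4 (hf1 a t)
  · obtain ⟨j, -, hj⟩ := hinv t
    exact ⟨j, hj.symm⟩

end

end CurvHom

end

theorem theorem1p9 (k : ℕ) (hk : 1 ≤ k) (ε : Fin k → ℤˣ) (f : Fin k → ℝ → ℝ)
    (hf : ∀ i, ContDiff ℝ ∞ (f i))
    (hf1 : ∀ i t, deriv (f i) t + 1 ≠ 0)
    (hf2 : ∀ i t, deriv (deriv (f i)) t ≠ 0) :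
    ¬ (CurvHom.metricF ε f hf).IsCurvatureHomogeneous 2 ∧
      ¬ (CurvHom.metricF ε f hf).IsLocallyHomogeneous := by
  have h := CurvHom.not_isCurvatureHomogeneous_two hk ε f hf hf1 fun i t => by
    unfold CurvHom.mixedCoeff
    rw [deriv_add_const]
    exact hf2 i t
  exact ⟨h, fun hl => h (hl.isCurvatureHomogeneous 2)⟩
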